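/- Let $D$ be a reduced alternating (planar) diagram of a prime link, where prime links are understood to be non-trivial and non-split. Let $Col(D)$ be the abelian group generated by the arcs of $D$ with one relation $2b-a-c=0$ for each crossing with over-arc $b$ and under-arcs $a$ and $c$, and let $Col^{red}(D)$ be the quotient of $Col(D)$ by the infinite cyclic subgroup generated by one (arbitrarily chosen) base arc. For a positive integer $k$, a Fox $k$-coloring of $D$ is a function $f$ from the arcs of $D$ to $\mathbb{Z}_k=\mathbb{Z}/k\mathbb{Z}$ such that $2f(b)-f(a)-f(c)=0$ in $\mathbb{Z}_k$ at each crossing with over-arc $b$ and under-arcs $a$ and $c$; it is non-trivial if it is not constant, and it distinguishes all arcs if it is injective. Suppose that $Col^{red}(D)$ is isomorphic to the cyclic group $\mathbb{Z}_{n_1}$, where $n_1$ is a positive integer. Then: (a) there exists a non-trivial Fox $n_1$-coloring of $D$ that distinguishes all arcs; (b) if moreover $n_1$ is a prime number, then every non-trivial Fox $n_1$-coloring of $D$ distinguishes all arcs (the original Kauffman–Harary conjecture). -/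

import Mathlib

/-- A (combinatorial, unoriented) link diagram on an oriented surface.
The four half-edges ("darts") at a crossing `v` are `(v, 0), (v, 1), (v, 2), (v, 3)`, listed
counterclockwise; `(v, 0), (v, 2)` are the two ends of the under-strand at `v` and
`(v, 1), (v, 3)` the two ends of the over-strand. The involution `opp` says which darts are joined
by an edge of the diagram, and `circles` is the number of components drawn without any crossing.
Diagrams in the plane (equivalently, on the sphere) are those that satisfy `LinkDiagram.Planar`. -/
structure LinkDiagram where
  Crossing : Type
  finite_crossing : Finite Crossing
  opp : Crossing × ZMod 4 → Crossing × ZMod 4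
  opp_opp : ∀ d, opp (opp d) = d
  opp_ne : ∀ d, opp d ≠ d
  circles : ℕ

namespace LinkDiagram

/-- Half-edges at the crossings. -/
abbrev Dart (D : LinkDiagram) : Type := D.Crossing × ZMod 4

/-- The dart belongs to the over-strand of its crossing. -/
def IsOver {D : LinkDiagram} (d : D.Dart) : Prop := d.2 = 1 ∨ d.2 = 3

/-- The next dart, counterclockwise, at the same crossing. -/
def rot {D : LinkDiagram} (d : D.Dart) : D.Dart := (d.1, d.2 + 1)

/-- The dart on the same strand on the other side of the same crossing. -/
def across {D : LinkDiagram} (d : D.Dart) : D.Dart := (d.1, d.2 + 2)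

/-- Walk along the edge `d` and turn into the next edge. The orbits of this permutation are the
boundary walks of the faces; the dart `d` stands for the corner at its crossing between the dart
preceding `d` and `d`. -/
def next (D : LinkDiagram) (d : D.Dart) : D.Dart := rot (D.opp d)

/-- The faces of the underlying 4-valent graph. -/
def Face (D : LinkDiagram) : Type := Quot (fun d e : D.Dart => e = D.next d)

/-- The connected components of the underlying 4-valent graph (crossingless circles not
included). -/
def GraphComponent (D : LinkDiagram) : Type :=
  Quot (fun v w : D.Crossing => ∃ i j : ZMod 4, D.opp (v, i) = (w, j))

/-- The link components that pass through at least one crossing. -/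
def Strand (D : LinkDiagram) : Type :=
  Quot (fun d e : D.Dart => e = D.opp d ∨ e = across d)

/-- The surface is a union of spheres, one for each connected component of the graph: Euler's
formula `V - E + F = 2 c` with `V` vertices and `E = 2 V` edges. (How the connected
components lie in the faces of each other is not recorded; it does not affect the link.) -/
def Planar (D : LinkDiagram) : Prop :=
  Nat.card D.Face = Nat.card D.Crossing + 2 * Nat.card D.GraphComponent

/-- The number of connected components of the diagram as a subset of the plane. -/
noncomputable def numPieces (D : LinkDiagram) : ℕ := Nat.card D.GraphComponent + D.circles

/-! ### Alternating and reduced diagrams -/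

/-- Over- and undercrossings alternate along each component: each edge leads from an overcrossing
to an undercrossing. -/
def Alternating (D : LinkDiagram) : Prop := ∀ d : D.Dart, IsOver (D.opp d) ↔ ¬ IsOver d

/-- A nugatory crossing: two opposite corners at `v` lie in the same face, that is, some
simple closed curve meets the diagram in `v` only and separates the four darts at `v` two from
two. -/
def Nugatory (D : LinkDiagram) (v : D.Crossing) : Prop :=
  ∃ i : ZMod 4, (Quot.mk _ (v, i) : D.Face) = Quot.mk _ (v, i + 2)

/-- A diagram without nugatory crossings. -/
def Reduced (D : LinkDiagram) : Prop := ∀ v, ¬ D.Nugatory v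

/-! ### Arcs, Fox colorings and the groups of colorings -/

/-- The arcs: maximal pieces of the diagram that run from undercrossing to undercrossing. Two darts
are on the same arc if they are linked by a chain of edges and overpasses. Each crossingless circle
is an arc as well. -/
def Arc (D : LinkDiagram) : Type :=
  Quot (fun d e : D.Dart => e = D.opp d ∨ (IsOver d ∧ e = across d)) ⊕ Fin D.circles

/-- The arc that contains a dart. -/
def arc (D : LinkDiagram) (d : D.Dart) : D.Arc := Sum.inl (Quot.mk _ d)

/-- Fox `k`-colorings: `2 b - a - c = 0` at each crossing with over-arc `b` and under-arcs
`a` and `c`. -/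
def IsFoxColoring (D : LinkDiagram) (k : ℕ) (f : D.Arc → ZMod k) : Prop :=
  ∀ v : D.Crossing, 2 * f (D.arc (v, 1)) - f (D.arc (v, 0)) - f (D.arc (v, 2)) = 0

/-- The relator `2 b - a - c` of a crossing, in the free abelian group on the arcs. -/
noncomputable def relator (D : LinkDiagram) (v : D.Crossing) : D.Arc →₀ ℤ :=
  2 • Finsupp.single (D.arc (v, 1)) 1 - Finsupp.single (D.arc (v, 0)) 1
    - Finsupp.single (D.arc (v, 2)) 1

/-- The group `Col(D)`: generators are the arcs, relators are those of the crossings. -/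
abbrev Col (D : LinkDiagram) : Type :=
  (D.Arc →₀ ℤ) ⧸ AddSubgroup.closure (Set.range D.relator)

/-- The generator of `Col(D)` given by an arc. -/
noncomputable def gen (D : LinkDiagram) (a : D.Arc) : D.Col :=
  QuotientAddGroup.mk (Finsupp.single a 1)

/-- The reduced group of colorings: the quotient of `Col(D)` by the infinite cyclic subgroup
generated by a base arc `b`. Up to isomorphism it does not depend on `b`. -/
abbrev ColRed (D : LinkDiagram) (b : D.Arc) : Type :=
  D.Col ⧸ AddSubgroup.zmultiples (D.gen b)

/-! ### Reidemeister moves and link equivalence -/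

/-- Orientation-preserving isomorphism: a bijection of the crossings which at each crossing
preserves the cyclic order and the under- and over-strand (so it is a rotation by `0` or `2`) and
which preserves edges. -/
def Iso (D D' : LinkDiagram) : Prop :=
  ∃ (e : D.Crossing ≃ D'.Crossing) (r : D.Crossing → ZMod 4),
    (∀ v, r v = 0 ∨ r v = 2) ∧
    (∀ d : D.Dart, D'.opp (e d.1, d.2 + r d.1) =
      (e (D.opp d).1, (D.opp d).2 + r (D.opp d).1)) ∧
    D.circles = D'.circles

/-- `D.Follow U d e`: arriving at the dart `d` and going straight on through all crossings in `U`,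
the first crossing outside `U` is met at its dart `e`. -/
inductive Follow (D : LinkDiagram) (U : Set D.Crossing) : D.Dart → D.Dart → Prop
  | arrive (d : D.Dart) (hd : d.1 ∉ U) : Follow D U d d
  | pass (d e : D.Dart) (hd : d.1 ∈ U) (h : Follow D U (D.opp (across d)) e) : Follow D U d e

/-- `D'` arises from `D` when the crossings in `U` are erased and the strands through them are
kept. Components that meet no crossing outside `U` become crossingless circles. -/
def ErasesTo (D : LinkDiagram) (U : Set D.Crossing) (D' : LinkDiagram) : Prop :=
  ∃ e : D'.Crossing ≃ {v : D.Crossing // v ∉ U},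
    (∀ d : D'.Dart,
      D.Follow U (D.opp ((e d.1).1, d.2)) ((e (D'.opp d).1).1, (D'.opp d).2)) ∧
    D'.circles = D.circles +
      Nat.card {c : D.Strand // ∀ d : D.Dart, (Quot.mk _ d : D.Strand) = c → d.1 ∈ U}

/-- First move: a kink (a face with one side) is removed. -/
def MoveOne (D D' : LinkDiagram) : Prop :=
  ∃ (x : D.Crossing) (i : ZMod 4), D.opp (x, i) = (x, i + 1) ∧ D.ErasesTo {x} D'

/-- Second move: a face with two sides, one of them passing over at both of its ends (and so the
other one under), at two distinct crossings, is removed together with these crossings. -/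
def MoveTwo (D D' : LinkDiagram) : Prop :=
  ∃ d : D.Dart, D.next (D.next d) = d ∧ (D.opp d).1 ≠ d.1 ∧ IsOver d ∧ IsOver (D.opp d) ∧
    D.ErasesTo {d.1, (D.opp d).1} D'

open scoped Classical in
/-- For an edge from `d` to `opp d`, the permutation of darts which exchanges the two crossings
at the ends of the edge on the strand through this edge. -/
noncomputable def exchange (D : LinkDiagram) (d : D.Dart) : Equiv.Perm D.Dart :=
  Equiv.swap d (across (D.opp d)) * Equiv.swap (across d) (D.opp d)

/-- Third move: there is a face with three sides and three distinct corners, with one side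
passing over at both of its ends (top strand; then of the other two sides one is
under at both ends and one is over at one end only). The move reverses, on each of the three
strands, the order of the two crossings of the triangle. -/
def MoveThree (D D' : LinkDiagram) : Prop :=
  ∃ d : D.Dart, D.next (D.next (D.next d)) = d ∧
    d.1 ≠ (D.next d).1 ∧ (D.next d).1 ≠ (D.next (D.next d)).1 ∧ (D.next (D.next d)).1 ≠ d.1 ∧
    IsOver d ∧ IsOver (D.opp d) ∧
    ∃ e : D.Crossing ≃ D'.Crossing, D.circles = D'.circles ∧
      ∀ c : D.Dart,
        let p : Equiv.Perm D.Dart :=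
          D.exchange d * D.exchange (D.next d) * D.exchange (D.next (D.next d))
        D'.opp (e c.1, c.2) = (e (p (D.opp (p c))).1, (p (D.opp (p c))).2)

/-- One isomorphism or Reidemeister move between planar diagrams. -/
def Step (D D' : LinkDiagram) : Prop :=
  D.Planar ∧ D'.Planar ∧ (Iso D D' ∨ MoveOne D D' ∨ MoveTwo D D' ∨ MoveThree D D')

/-- Two diagrams represent the same (unoriented) link: they are connected by a finite sequence of
Reidemeister moves, in either direction, through planar diagrams. -/
def SameLink (D D' : LinkDiagram) : Prop := Relation.EqvGen Step D D'

/-! ### Prime links -/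

/-- The diagram of the unknot without crossings. -/
def unknot : LinkDiagram where
  Crossing := Empty
  finite_crossing := inferInstance
  opp := fun d => d
  opp_opp := fun _ => rfl
  opp_ne := fun d => d.1.elim
  circles := 1

/-- The edge pairing of the disjoint union of two diagrams. -/
def sumOpp (D E : LinkDiagram) :
    (D.Crossing ⊕ E.Crossing) × ZMod 4 → (D.Crossing ⊕ E.Crossing) × ZMod 4
  | (Sum.inl v, i) => (Sum.inl (D.opp (v, i)).1, (D.opp (v, i)).2)
  | (Sum.inr v, i) => (Sum.inr (E.opp (v, i)).1, (E.opp (v, i)).2)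

theorem sumOpp_sumOpp (D E : LinkDiagram) (d : (D.Crossing ⊕ E.Crossing) × ZMod 4) :
    sumOpp D E (sumOpp D E d) = d := by
  rcases d with ⟨v | v, i⟩
  · simp [sumOpp, D.opp_opp]
  · simp [sumOpp, E.opp_opp]

theorem sumOpp_ne (D E : LinkDiagram) (d : (D.Crossing ⊕ E.Crossing) × ZMod 4) :
    sumOpp D E d ≠ d := by
  rcases d with ⟨v | v, i⟩
  · intro h
    simp only [sumOpp, Prod.mk.injEq, Sum.inl.injEq] at h
    exact D.opp_ne (v, i) (Prod.ext h.1 h.2)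
  · intro h
    simp only [sumOpp, Prod.mk.injEq, Sum.inr.injEq] at h
    exact E.opp_ne (v, i) (Prod.ext h.1 h.2)

open scoped Classical in
/-- The connected sum of `D` and `E` at the edges from `a` to `opp a` and from `b` to `opp b`:
these two edges are cut, and `a` is joined to `b` and `opp a` to `opp b`. -/
noncomputable def connSum (D E : LinkDiagram) (a : D.Dart) (b : E.Dart) : LinkDiagram where
  Crossing := D.Crossing ⊕ E.Crossing
  finite_crossing := by
    have := D.finite_crossing
    have := E.finite_crossing
    infer_instance
  opp := fun d =>
    let s := Equiv.swap ((Sum.inl (D.opp a).1, (D.opp a).2) : (D.Crossing ⊕ E.Crossing) × ZMod 4)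
      (Sum.inr b.1, b.2)
    s (sumOpp D E (s d))
  opp_opp := fun d => by simp [sumOpp_sumOpp]
  opp_ne := fun d h => sumOpp_ne D E _ (by
    have h2 := congrArg (Equiv.swap (Sum.inl (D.opp a).1, (D.opp a).2) (Sum.inr b.1, b.2)) h
    simpa only [Equiv.swap_apply_self] using h2)
  circles := D.circles + E.circles

/-- `D` represents a prime link: the link is non-trivial, it is not split (nor empty), and whenever
it is a connected sum of two links, one of these is the unknot. All three conditions range over all
planar diagrams of the link. -/
def RepresentsPrimeLink (D : LinkDiagram) : Prop :=
  ¬ D.SameLink unknot ∧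
  (∀ E : LinkDiagram, D.SameLink E → E.numPieces = 1) ∧
  (∀ (E F : LinkDiagram) (a : E.Dart) (b : F.Dart),
    D.SameLink (connSum E F a b) → E.SameLink unknot ∨ F.SameLink unknot)

end LinkDiagram

namespace LinkDiagram

section Colorings

variable {D D' : LinkDiagram} {A : Type} [AddCommGroup A]

/-! The core is that distinct arcs give distinct elements of `Col(D)` (`gen_injective`). In an
alternating diagram without circles each arc passes over exactly one crossing, so arcs are indexed
by crossings. If the arcs of `x` and `y` had the same class, their difference would be an integral
combination of relators, and the coefficients would form a potential on the crossings with Laplacian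
`δ_x - δ_y` along the over-strands. By a maximum principle the set where the potential is maximal
contains `x`, not `y`, and is left by a single over-edge, hence by alternation also by a single
under-edge (`exists_cut_of_gen_eq`). Such a two-edge cut exhibits `D` as a connected sum of two
connected alternating diagrams (`EdgeCut.iso_connSum`), which have no loops because `D` is reduced
(`EdgeCut.side_no_loop`).

Primality is contradicted once neither summand is an unknot. The invariant used is `RigidOff`: all
colorings in a given abelian group are constant. It is invariant under Reidemeister moves
(`SameLink.rigidOff_iff`) and holds for the unknot. A connected loopless alternating diagram with a
crossing violates it for the group `Col` (`not_rigidOff`): otherwise all generators coincide, any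
two crossings are separated by a cut, and uncrossing a smallest cut with another one gives a
contradiction.

The degree homomorphism `Col(D) → ℤ` carries injectivity over to the reduced group
(`redGen_injective`). An isomorphism with `ZMod n₁` is then an injective coloring. For prime `n₁`,
any non-trivial coloring differs from it by a constant and a nonzero, hence injective, endomorphism
of `ZMod n₁`. -/

theorem isOver_iff (d : D.Dart) : IsOver d ↔ d.2 = 1 ∨ d.2 = 3 := Iff.rfl

theorem zmod_four_not_odd {i : ZMod 4} : ¬ (i = 1 ∨ i = 3) ↔ i = 0 ∨ i = 2 := by
  revert i; decide

theorem not_isOver_iff (d : D.Dart) : ¬ IsOver d ↔ d.2 = 0 ∨ d.2 = 2 := zmod_four_not_odd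

@[simp] theorem across_across (d : D.Dart) : across (across d) = d := by
  have h : ∀ i : ZMod 4, i + 2 + 2 = i := by decide
  exact Prod.ext rfl (h _)

theorem across_ne (d : D.Dart) : across d ≠ d := by
  have h : ∀ i : ZMod 4, i + 2 ≠ i := by decide
  exact fun e => h _ (congrArg Prod.snd e)

@[simp] theorem isOver_across (d : D.Dart) : IsOver (across d) ↔ IsOver d := by
  have h : ∀ i : ZMod 4, (i + 2 = 1 ∨ i + 2 = 3) ↔ (i = 1 ∨ i = 3) := by decide
  exact h _

@[simp] theorem isOver_rot (d : D.Dart) : IsOver (rot d) ↔ ¬ IsOver d := by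
  have h : ∀ i : ZMod 4, (i + 1 = 1 ∨ i + 1 = 3) ↔ ¬ (i = 1 ∨ i = 3) := by decide
  exact h _

theorem rot_injective : Function.Injective (rot : D.Dart → D.Dart) := by
  rintro ⟨v, i⟩ ⟨w, j⟩ h
  simpa [rot] using h

theorem across_rot (d : D.Dart) : across (rot d) = rot (across d) :=
  Prod.ext rfl (add_right_comm _ _ _)

/-- Two darts at one crossing lie on the same strand or on different strands of it. -/
theorem eq_or_eq_across {d e : D.Dart} (h : d.1 = e.1) (ho : IsOver d ↔ IsOver e) :
    d = e ∨ d = across e := by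
  have key : ∀ i j : ZMod 4, ((i = 1 ∨ i = 3) ↔ (j = 1 ∨ j = 3)) → i = j ∨ i = j + 2 := by decide
  exact (key _ _ ho).imp (Prod.ext h) (Prod.ext h)

theorem opp_injective (D : LinkDiagram) : Function.Injective D.opp :=
  Function.LeftInverse.injective D.opp_opp

theorem opp_eq_iff {d e : D.Dart} : D.opp d = e ↔ d = D.opp e :=
  ⟨fun h => by rw [← h, D.opp_opp], fun h => by rw [h, D.opp_opp]⟩

/-! ### Colorings with values in an abelian group -/

/-- Colorings of the edges by elements of an abelian group, where the crossings in `U` are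
disregarded: the strands just go through each other there. -/
structure IsColoringOff (D : LinkDiagram) (U : Set D.Crossing) (f : D.Dart → A) : Prop where
  opp : ∀ d, f (D.opp d) = f d
  across : ∀ d, IsOver d ∨ d.1 ∈ U → f (across d) = f d
  crossing : ∀ v ∉ U, f (v, 1) + f (v, 1) = f (v, 0) + f (v, 2)

/-- All colorings, the circles included, are constant. -/
def RigidOff (D : LinkDiagram) (U : Set D.Crossing) (A : Type) [AddCommGroup A] : Prop :=
  ∀ (f : D.Dart → A) (g : Fin D.circles → A), D.IsColoringOff U f →
    ∃ a, (∀ d, f d = a) ∧ ∀ i, g i = a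

theorem IsColoringOff.crossing' {U : Set D.Crossing} {f : D.Dart → A} (hf : D.IsColoringOff U f)
    {b u : D.Dart} (hb : IsOver b) (hu : ¬ IsOver u) (h : b.1 = u.1) (hU : u.1 ∉ U) :
    f b + f b = f u + f (LinkDiagram.across u) := by
  obtain ⟨v, i⟩ := b
  obtain ⟨w, j⟩ := u
  obtain rfl : v = w := h
  have h1 := hf.crossing v hU
  have h3 : f (v, 3) = f (v, 1) := hf.across (v, 1) (Or.inl (Or.inl rfl))
  rw [not_isOver_iff] at hu
  rcases hb with rfl | rfl <;> rcases hu with rfl | rfl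
  · exact h1
  · exact h1.trans (add_comm _ _)
  · rw [h3]; exact h1
  · rw [h3]; exact h1.trans (add_comm _ _)

theorem isColoringOff_of_darts {U : Set D.Crossing} {f : D.Dart → A}
    (h₁ : ∀ d, f (D.opp d) = f d) (h₂ : ∀ d, IsOver d ∨ d.1 ∈ U → f (across d) = f d)
    (h₃ : ∀ v ∉ U, ∃ b u : D.Dart, b.1 = v ∧ u.1 = v ∧ IsOver b ∧ ¬ IsOver u ∧
      f b + f b = f u + f (LinkDiagram.across u)) : D.IsColoringOff U f := by
  refine ⟨h₁, h₂, fun v hv => ?_⟩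
  obtain ⟨⟨w, i⟩, ⟨w', j⟩, hw, hw', hb, hu, e⟩ := h₃ v hv
  obtain rfl : w = v := hw
  obtain rfl : w' = w := hw'
  have h3 := h₂ (w', 1) (Or.inl (Or.inl rfl))
  rw [not_isOver_iff] at hu
  have z : (2 : ZMod 4) + 2 = 0 := by decide
  have z' : (1 : ZMod 4) + 2 = 3 := by decide
  simp only [LinkDiagram.across, z'] at h3
  simp only [LinkDiagram.across] at e
  rcases hb with hb | hb <;> rcases hu with hu | hu <;> dsimp only at hb hu <;> subst hb <;>
    subst hu <;> simp only [z, zero_add, h3] at e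
  · exact e
  · exact e.trans (add_comm _ _)
  · exact e
  · exact e.trans (add_comm _ _)

theorem rigidOff_iso (h : Iso D D') (hr : RigidOff D' ∅ A) : RigidOff D ∅ A := by
  obtain ⟨e, r, hr02, hopp, hc⟩ := h
  intro f g hf
  have hs : ∀ v, r (e.symm v) = 0 ∨ r (e.symm v) = 2 := fun v => hr02 _
  let f' : D'.Dart → A := fun d => f (e.symm d.1, d.2 - r (e.symm d.1))
  have hf' : D'.IsColoringOff ∅ f' := by
    refine ⟨fun d => ?_, fun d hd => ?_, fun v _ => ?_⟩
    · have := hopp (e.symm d.1, d.2 - r (e.symm d.1))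
      simp only [Equiv.apply_symm_apply, sub_add_cancel] at this
      have h2 : D'.opp d = D'.opp (d.1, d.2) := rfl
      simp only [f', h2, this, Equiv.symm_apply_apply, add_sub_cancel_right]
      exact hf.opp _
    · have hd' : IsOver d := by simpa using hd
      have h2 : IsOver ((e.symm d.1, d.2 - r (e.symm d.1)) : D.Dart) := by
        rcases hs d.1 with h | h <;> rw [isOver_iff, h]
        · simpa using (isOver_iff d).1 hd'
        · have k : ∀ i : ZMod 4, (i = 1 ∨ i = 3) → (i - 2 = 1 ∨ i - 2 = 3) := by decide
          exact k _ hd'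
      have h3 := hf.across _ (Or.inl h2)
      simp only [across] at h3
      simp only [f', across, add_sub_right_comm]
      exact h3
    · have h1 := hf.crossing (e.symm v) (by simp)
      have h3 : f (e.symm v, 3) = f (e.symm v, 1) := hf.across (_, 1) (Or.inl (Or.inl rfl))
      have z1 : (1 : ZMod 4) - 2 = 3 := by decide
      have z2 : (0 : ZMod 4) - 2 = 2 := by decide
      rcases hs v with h | h <;> simp only [f', h, sub_zero, sub_self, z1, z2]
      · exact h1
      · rw [h3, h1, add_comm]
  obtain ⟨a, h1, h2⟩ := hr f' (fun i => g (Fin.cast hc.symm i)) hf'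
  refine ⟨a, fun d => ?_, fun i => by simpa using h2 (Fin.cast hc i)⟩
  have := h1 (e d.1, d.2 + r d.1)
  simpa [f'] using this

theorem Iso.symm (h : Iso D D') : Iso D' D := by
  obtain ⟨e, r, hr, hopp, hc⟩ := h
  have k : ∀ i j : ZMod 4, (j = 0 ∨ j = 2) → i + j + j = i := by decide
  refine ⟨e.symm, fun v => r (e.symm v), fun v => hr _, fun d => ?_, hc.symm⟩
  have h1 := hopp (e.symm d.1, d.2 + r (e.symm d.1))
  simp only [Equiv.apply_symm_apply] at h1
  rw [k _ _ (hr _)] at h1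
  have h2 : D'.opp d = D'.opp (d.1, d.2) := rfl
  rw [h2, h1]
  simp only [Equiv.symm_apply_apply]
  rw [k _ _ (hr _)]

/-! ### Erasing crossings -/

theorem Follow.unique {U : Set D.Crossing} {d e e' : D.Dart} (h : D.Follow U d e)
    (h' : D.Follow U d e') : e = e' := by
  induction h with
  | arrive d hd =>
    cases h' with
    | arrive => rfl
    | pass _ _ hd' => exact absurd hd' hd
  | pass d e hd _ ih =>
    cases h' with
    | arrive _ hd' => exact absurd hd hd'
    | pass _ _ _ h => exact ih h

theorem Follow.notMem {U : Set D.Crossing} {d e : D.Dart} (h : D.Follow U d e) : e.1 ∉ U := by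
  induction h with
  | arrive d hd => exact hd
  | pass d e hd _ ih => exact ih

theorem follow_pass_iff {U : Set D.Crossing} {d e : D.Dart} (hd : d.1 ∈ U) :
    D.Follow U d e ↔ D.Follow U (D.opp (across d)) e := by
  refine ⟨fun h => ?_, Follow.pass d e hd⟩
  cases h with
  | arrive _ hd' => exact absurd hd hd'
  | pass _ _ _ h => exact h

/-- Following a strand backwards. -/
theorem Follow.opp_iff {U : Set D.Crossing} {d e x : D.Dart} (h : D.Follow U d e) :
    D.Follow U (D.opp e) x ↔ D.Follow U (D.opp d) x := by
  induction h with
  | arrive => rfl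
  | pass d e hd _ ih =>
    rw [ih, D.opp_opp, follow_pass_iff (d := across d) hd, across_across]

theorem Follow.apply_eq {U : Set D.Crossing} {B : Type} {f : D.Dart → B}
    (h₁ : ∀ d, f (D.opp d) = f d) (h₂ : ∀ d, d.1 ∈ U → f (across d) = f d) {d e : D.Dart}
    (h : D.Follow U d e) : f e = f d := by
  induction h with
  | arrive => rfl
  | pass d e hd _ ih => rw [ih, h₁, h₂ d hd]

/-- A property of darts that is invariant along edges and through crossings is a property of
strands. -/
theorem strand_iff {P : D.Dart → Prop} (h₁ : ∀ d, P (D.opp d) ↔ P d)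
    (h₂ : ∀ d, P (across d) ↔ P d) {d e : D.Dart}
    (h : (Quot.mk _ d : D.Strand) = Quot.mk _ e) : P d ↔ P e := by
  let Q : D.Strand → Prop := Quot.lift P (by
    rintro a b (rfl | rfl)
    · exact propext (h₁ a).symm
    · exact propext (h₂ a).symm)
  exact iff_of_eq (congrArg Q h)

theorem strand_opp (d : D.Dart) : (Quot.mk _ (D.opp d) : D.Strand) = Quot.mk _ d :=
  (Quot.sound (r := fun d e : D.Dart => e = D.opp d ∨ e = across d) (Or.inl rfl)).symm

theorem strand_across (d : D.Dart) : (Quot.mk _ (across d) : D.Strand) = Quot.mk _ d :=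
  (Quot.sound (r := fun d e : D.Dart => e = D.opp d ∨ e = across d) (Or.inr rfl)).symm

theorem finite_strand (D : LinkDiagram) : Finite D.Strand := by
  have := D.finite_crossing
  have : Finite D.Dart := Finite.instProd
  exact Quot.finite _

/-- The strands all of whose crossings are in `U`. -/
abbrev InnerStrand (D : LinkDiagram) (U : Set D.Crossing) : Type :=
  {c : D.Strand // ∀ d : D.Dart, (Quot.mk _ d : D.Strand) = c → d.1 ∈ U}

theorem exists_circles_equiv {U : Set D.Crossing}
    (h : D'.circles = D.circles + Nat.card (D.InnerStrand U)) :
    Nonempty (Fin D'.circles ≃ Fin D.circles ⊕ D.InnerStrand U) := by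
  have := D.finite_strand
  refine ⟨(finCongr h).trans (finSumFinEquiv.symm.trans (Equiv.sumCongr (Equiv.refl _) ?_))⟩
  exact (Finite.equivFin _).symm

/-- A coloring off `U` restricts to the remaining crossings, and it is constant on each strand
inside `U`, which supplies the color of the new circle. -/
theorem rigidOff_of_erasesTo {U : Set D.Crossing} (h : D.ErasesTo U D')
    (hr : RigidOff D' ∅ A) : RigidOff D U A := by
  obtain ⟨e, hfol, hc⟩ := h
  obtain ⟨φ⟩ := exists_circles_equiv hc
  intro f g hf
  let f' : D'.Dart → A := fun d => f ((e d.1).1, d.2)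
  let g' : Fin D'.circles → A := fun i => Sum.elim g (fun s => f s.1.out) (φ i)
  have hf' : D'.IsColoringOff ∅ f' := by
    refine ⟨fun d => ?_, fun d hd => ?_, fun v _ => ?_⟩
    · exact ((hfol d).apply_eq hf.opp fun d hd => hf.across d (Or.inr hd)).trans (hf.opp _)
    · exact hf.across ((e d.1).1, d.2) (Or.inl (show IsOver d by simpa using hd))
    · exact hf.crossing _ (e v).2
  obtain ⟨a, h1, h2⟩ := hr f' g' hf'
  have hout : ∀ d : D.Dart, d.1 ∉ U → f d = a := fun d hd => by
    simpa [f'] using h1 (e.symm ⟨d.1, hd⟩, d.2)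
  refine ⟨a, fun d => ?_, fun i => by simpa [g'] using h2 (φ.symm (Sum.inl i))⟩
  have hstr : ∀ {d d' : D.Dart}, (Quot.mk _ d : D.Strand) = Quot.mk _ d' →
      (f d = a ↔ f d' = a) :=
    strand_iff (P := fun d => f d = a) (fun d => by rw [hf.opp]) (fun d => by
      by_cases hd : d.1 ∈ U
      · rw [hf.across d (Or.inr hd)]
      · simp [hout d hd, hout (across d) hd])
  by_cases hin : ∀ d' : D.Dart, (Quot.mk _ d' : D.Strand) = Quot.mk _ d → d'.1 ∈ U
  · have h3 : f (Quot.out (Quot.mk _ d : D.Strand)) = a := by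
      simpa [g'] using h2 (φ.symm (Sum.inr ⟨Quot.mk _ d, hin⟩))
    exact (hstr (Quot.out_eq _)).1 h3
  · push Not at hin
    obtain ⟨d', h3, h4⟩ := hin
    exact (hstr h3).1 (hout d' h4)

-- A coloring of `D'` is extended to `D`: a dart takes the color found where its strand first leaves
-- `U`, or, if the strand never leaves `U`, the color of the circle it has become.
open scoped Classical in
theorem rigidOff_erasesTo {U : Set D.Crossing} (h : D.ErasesTo U D')
    (hr : RigidOff D U A) : RigidOff D' ∅ A := by
  obtain ⟨e, hfol, hc⟩ := h
  obtain ⟨φ⟩ := exists_circles_equiv hc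
  intro f' g' hf'
  -- `N` fails exactly on the strands inside `U`, where following the strand never ends.
  let N : D.Dart → Prop := fun d => ∃ x, D.Follow U d x
  have hout : ∀ d : D.Dart, d.1 ∉ U → ∃ c : D'.Dart, d = ((e c.1).1, c.2) := fun d hd =>
    ⟨(e.symm ⟨d.1, hd⟩, d.2), by simp⟩
  have hNopp' : ∀ d, N d → N (D.opp d) := by
    rintro d ⟨x, hx⟩
    obtain ⟨c, rfl⟩ := hout x hx.notMem
    exact ⟨_, hx.opp_iff.1 (hfol c)⟩
  have hNopp : ∀ d, N (D.opp d) ↔ N d := fun d =>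
    ⟨fun h => by simpa [D.opp_opp] using hNopp' _ h, hNopp' d⟩
  have hNacross : ∀ d, N (across d) ↔ N d := fun d => by
    by_cases hd : d.1 ∈ U
    · rw [← hNopp (across d)]
      exact (exists_congr fun x => follow_pass_iff hd).symm
    · exact iff_of_true ⟨_, .arrive _ hd⟩ ⟨_, .arrive _ hd⟩
  have hin : ∀ d, ¬ N d → ∀ d' : D.Dart, (Quot.mk _ d' : D.Strand) = Quot.mk _ d → d'.1 ∈ U := by
    intro d hd d' h
    by_contra hd'
    exact hd ((strand_iff hNopp hNacross h).1 ⟨_, .arrive _ hd'⟩)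
  let col : D.Dart → A := fun x => if hx : x.1 ∈ U then 0 else f' (e.symm ⟨x.1, hx⟩, x.2)
  have hcol : ∀ c : D'.Dart, col ((e c.1).1, c.2) = f' c := fun c => by
    simp [col, (e c.1).2]
  let f : D.Dart → A := fun d =>
    if h : N d then col h.choose else g' (φ.symm (Sum.inr ⟨Quot.mk _ d, hin d h⟩))
  have hfN : ∀ {d x}, D.Follow U d x → f d = col x := fun {d x} h => by
    have hN : N d := ⟨x, h⟩
    simp only [f, dif_pos hN]
    rw [hN.choose_spec.unique h]
  have hfn : ∀ {d} (h : ¬ N d), f d = g' (φ.symm (Sum.inr ⟨Quot.mk _ d, hin d h⟩)) :=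
    fun {d} h => by simp only [f, dif_neg h]
  have hfout : ∀ c : D'.Dart, f ((e c.1).1, c.2) = f' c := fun c => by
    rw [hfN (.arrive _ (e c.1).2), hcol]
  have hopp : ∀ d, f (D.opp d) = f d := fun d => by
    by_cases h : N d
    · obtain ⟨x, hx⟩ := h
      obtain ⟨c, rfl⟩ := hout x hx.notMem
      rw [hfN hx, hfN (hx.opp_iff.1 (hfol c)), hcol, hcol, hf'.opp]
    · have h' : ¬ N (D.opp d) := by rwa [hNopp]
      rw [hfn h, hfn h']
      congr 4
      exact strand_opp d
  have hpass : ∀ d : D.Dart, d.1 ∈ U → f (across d) = f d := fun d hd => by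
    rw [← hopp (across d)]
    by_cases h : N d
    · obtain ⟨x, hx⟩ := h
      rw [hfN hx, hfN ((follow_pass_iff hd).1 hx)]
    · have h' : ¬ N (D.opp (across d)) := by rwa [hNopp, hNacross]
      rw [hfn h, hfn h']
      congr 4
      exact (strand_opp _).trans (strand_across d)
  have hf : D.IsColoringOff U f := by
    refine ⟨hopp, fun d hd => ?_, fun v hv => ?_⟩
    · by_cases hU : d.1 ∈ U
      · exact hpass d hU
      · have hd : IsOver d := hd.resolve_right hU
        obtain ⟨c, rfl⟩ := hout d hU
        exact (hfout (across c)).trans ((hf'.across c (Or.inl hd)).trans (hfout c).symm)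
    · obtain ⟨c, hc⟩ := hout (v, 0) hv
      have hv' : v = (e c.1).1 := congrArg Prod.fst hc
      have h3 := hf'.crossing c.1 (by simp)
      rw [← hfout, ← hfout, ← hfout] at h3
      rw [hv']
      exact h3
  obtain ⟨a, h1, h2⟩ := hr f (fun i => g' (φ.symm (Sum.inl i))) hf
  refine ⟨a, fun d => by rw [← hfout, h1], fun i => ?_⟩
  obtain ⟨s, rfl⟩ := φ.symm.surjective i
  rcases s with i | ⟨s, hs⟩
  · exact h2 i
  · obtain ⟨d, rfl⟩ := Quot.exists_rep s
    have hN : ¬ N d := by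
      rintro ⟨x, hx⟩
      have hx' := hx.notMem
      refine hx' (hs x ?_)
      exact hx.apply_eq (f := fun d => (Quot.mk _ d : D.Strand))
        strand_opp (fun d _ => strand_across d)
    rw [← hfn hN, h1]

/-- The loop gives an over-dart and an under-dart at `x` the same color, so `2b = a + c` with `a =
b` forces `c = b`: the relation says no more than that all four colors agree. -/
theorem isColoringOff_kink {x : D.Crossing} {i : ZMod 4} (h : D.opp (x, i) = (x, i + 1))
    (f : D.Dart → A) : D.IsColoringOff ∅ f ↔ D.IsColoringOff {x} f := by
  constructor
  · intro hf
    refine ⟨hf.opp, fun d hd => ?_, fun v _ => hf.crossing v (by simp)⟩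
    by_cases hov : IsOver d
    · exact hf.across d (Or.inl hov)
    have hdx : d.1 = x := hd.resolve_left hov
    have hk : f (x, i + 1) = f (x, i) := by rw [← h, hf.opp]
    have hi : ∃ b u : D.Dart, b.1 = x ∧ u.1 = x ∧ IsOver b ∧ ¬ IsOver u ∧ f b = f u := by
      by_cases hi : IsOver ((x, i) : D.Dart)
      · exact ⟨(x, i), (x, i + 1), rfl, rfl, hi, fun h' => (isOver_rot (x, i)).1 h' hi, hk.symm⟩
      · exact ⟨(x, i + 1), (x, i), rfl, rfl, (isOver_rot (x, i)).2 hi, hi, hk⟩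
    obtain ⟨b, u, hb, hu, hob, hou, e⟩ := hi
    have h1 := hf.crossing' hob hou (hb.trans hu.symm) (by simp)
    rw [e] at h1
    have h2 := add_left_cancel h1
    rcases eq_or_eq_across (hdx.trans hu.symm) (iff_of_false hov hou) with rfl | rfl
    · exact h2.symm
    · rw [across_across, h2]
  · intro hf
    refine ⟨hf.opp, fun d hd => hf.across d (Or.inl (by simpa using hd)), fun v _ => ?_⟩
    by_cases hv : v = x
    · subst hv
      have hx : ∀ j : ZMod 4, f (v, j + 2) = f (v, j) := fun j => hf.across (v, j) (Or.inr rfl)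
      have hk : f (v, i + 1) = f (v, i) := by rw [← h, hf.opp]
      have h0 : f (v, 2) = f (v, 0) := hx 0
      have h1 : f (v, 3) = f (v, 1) := hx 1
      have h01 : f (v, 1) = f (v, 0) := by
        have : ∀ j : ZMod 4, j = 0 ∨ j = 1 ∨ j = 2 ∨ j = 3 := by decide
        rcases this i with rfl | rfl | rfl | rfl
        · exact hk
        · exact hk.symm.trans h0
        · exact h1.symm.trans (hk.trans h0)
        · exact h1.symm.trans hk.symm
      rw [h0, h01]
    · exact hf.crossing v hv

theorem rigidOff_moveOne (h : MoveOne D D') : RigidOff D ∅ A ↔ RigidOff D' ∅ A := by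
  obtain ⟨x, i, hk, he⟩ := h
  have : RigidOff D ∅ A ↔ RigidOff D {x} A := by
    simp only [RigidOff, isColoringOff_kink hk]
  rw [this]
  exact ⟨rigidOff_erasesTo he, rigidOff_of_erasesTo he⟩

theorem fst_congr {d e : D.Dart} (h : d = e) : d.1 = e.1 := congrArg Prod.fst h

theorem iff_of_not_iff {p q r : Prop} (h : ¬ (p ↔ q)) (h' : q ↔ ¬ r) : p ↔ r := by tauto

/-! ### Removing a bigon -/

-- The two kinds of colorings differ only on the middle edge of the under-strand: it has the outer
-- color `a` if the crossings are disregarded and `2b - a` otherwise, `b` being the color of the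
-- over-strand. The reflection `T` of that edge passes from either kind to the other.
open scoped Classical in
theorem rigidOff_bigon {d : D.Dart} (h : D.next (D.next d) = d) (hne : (D.opp d).1 ≠ d.1)
    (ho : IsOver d) (ho' : IsOver (D.opp d)) :
    RigidOff D ∅ A ↔ RigidOff D {d.1, (D.opp d).1} A := by
  obtain ⟨c, hc⟩ : ∃ c, c = D.next d := ⟨_, rfl⟩
  have hc1 : c.1 = (D.opp d).1 := by rw [hc]; rfl
  have hcu : ¬ IsOver c := by rw [hc]; exact fun h' => (isOver_rot _).1 h' ho'
  have hrot : rot (D.opp c) = d := by rw [hc]; exact h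
  have hc2 : (D.opp c).1 = d.1 := by rw [← hrot]; rfl
  have hcu' : ¬ IsOver (D.opp c) := by rw [← isOver_rot, hrot]; exact ho
  let T : (D.Dart → A) → D.Dart → A := fun f x =>
    if x = c ∨ x = D.opp c then f d + f d - f x else f x
  have hTin : ∀ f : D.Dart → A, (∀ x, f (D.opp x) = f x) →
      T f c = f d + f d - f c ∧ T f (D.opp c) = f d + f d - f c := fun f hf => by
    simp [T, hf c]
  have hTover : ∀ (f : D.Dart → A) {x}, IsOver x → T f x = f x := fun f x hx => by
    refine if_neg ?_
    rintro (rfl | rfl)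
    · exact hcu hx
    · exact hcu' hx
  have hTout : ∀ (f : D.Dart → A) {x}, x.1 ∉ ({d.1, (D.opp d).1} : Set D.Crossing) → T f x = f x :=
    fun f x hx => by
      refine if_neg ?_
      rintro (rfl | rfl)
      · exact hx (by simp [hc1])
      · exact hx (by simp [hc2])
  have hTacross : ∀ f : D.Dart → A, T f (across c) = f (across c) ∧
      T f (across (D.opp c)) = f (across (D.opp c)) := fun f => by
    constructor <;> refine if_neg ?_ <;> rintro (h' | h')
    · exact across_ne _ h'
    · exact hne (by rw [← hc1, ← hc2]; exact (fst_congr h' :))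
    · exact hne (by rw [← hc1, ← hc2]; exact (fst_congr h').symm)
    · exact across_ne _ h'
  have hTopp : ∀ f : D.Dart → A, (∀ x, f (D.opp x) = f x) → ∀ x, T f (D.opp x) = T f x := by
    intro f hf x
    by_cases hx : x = c ∨ x = D.opp c
    · rcases hx with rfl | rfl
      · rw [(hTin f hf).1, (hTin f hf).2]
      · rw [D.opp_opp, (hTin f hf).1, (hTin f hf).2]
    · have hx' : ¬ (D.opp x = c ∨ D.opp x = D.opp c) := by
        rw [opp_eq_iff, opp_eq_iff, D.opp_opp]
        exact fun h' => hx h'.symm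
      simp only [T, if_neg hx, if_neg hx', hf]
  have hTconst : ∀ f : D.Dart → A, ∀ a, (∀ x, T f x = a) → ∀ x, f x = a := by
    intro f a ha x
    have hd : f d = a := by rw [← hTover f ho, ha]
    have hx := ha x
    by_cases hx' : x = c ∨ x = D.opp c
    · simp only [T, if_pos hx', hd] at hx
      rw [sub_eq_iff_eq_add] at hx
      exact (add_left_cancel hx).symm
    · simpa only [T, if_neg hx'] using hx
  have hfd : ∀ {U} {f : D.Dart → A}, D.IsColoringOff U f → f (D.opp d) = f d :=
    fun hf => hf.opp d
  have hunder : ∀ x : D.Dart, x.1 ∈ ({d.1, (D.opp d).1} : Set D.Crossing) → ¬ IsOver x →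
      (x = c ∨ x = across c) ∨ (x = D.opp c ∨ x = across (D.opp c)) := by
    intro x hx hxu
    rcases hx with hx | hx
    · exact Or.inr (eq_or_eq_across (hx.trans hc2.symm) (iff_of_false hxu hcu'))
    · exact Or.inl (eq_or_eq_across (Eq.trans hx hc1.symm) (iff_of_false hxu hcu))
  constructor
  · intro hr f g hf
    have hf' : D.IsColoringOff ∅ (T f) := by
      refine isColoringOff_of_darts (hTopp f hf.opp) (fun x hx => ?_) (fun v _ => ?_)
      · have hx : IsOver x := by simpa using hx
        rw [hTover f hx, hTover f (by simpa using hx), hf.across x (Or.inl hx)]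
      · by_cases hv : v ∈ ({d.1, (D.opp d).1} : Set D.Crossing)
        · rcases hv with rfl | hv
          · refine ⟨d, D.opp c, rfl, hc2, ho, hcu', ?_⟩
            rw [hTover f ho, (hTin f hf.opp).2, (hTacross f).2,
              hf.across (D.opp c) (Or.inr (by simp [hc2])), hf.opp, sub_add_cancel]
          · refine ⟨D.opp d, c, hv.symm, hc1.trans hv.symm, ho', hcu, ?_⟩
            rw [hTover f ho', (hTin f hf.opp).1, (hTacross f).1,
              hf.across c (Or.inr (by simp [hc1])), hfd hf, sub_add_cancel]
        · refine ⟨(v, 1), (v, 0), rfl, rfl, Or.inl rfl, by rw [not_isOver_iff]; simp, ?_⟩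
          have e : across ((v, 0) : D.Dart) = (v, 2) := by simp [across]
          rw [hTout f hv, hTout f hv, e, hTout f hv, hf.crossing v hv]
    obtain ⟨a, h1, h2⟩ := hr (T f) g hf'
    exact ⟨a, hTconst f a h1, h2⟩
  · intro hr f g hf
    have hf' : D.IsColoringOff {d.1, (D.opp d).1} (T f) := by
      refine ⟨hTopp f hf.opp, fun x hx => ?_, fun v hv => ?_⟩
      · by_cases hxo : IsOver x
        · rw [hTover f hxo, hTover f (by simpa using hxo), hf.across x (Or.inl hxo)]
        · have k1 := hf.crossing' ho' hcu hc1.symm (by simp)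
          have k2 := hf.crossing' ho hcu' hc2.symm (by simp)
          rw [hfd hf] at k1
          rw [hf.opp] at k2
          rcases hunder x (hx.resolve_left hxo) hxo with (rfl | rfl) | (rfl | rfl)
          · rw [(hTin f hf.opp).1, (hTacross f).1, k1, add_sub_cancel_left]
          · rw [across_across, (hTin f hf.opp).1, (hTacross f).1, k1, add_sub_cancel_left]
          · rw [(hTin f hf.opp).2, (hTacross f).2, k2, add_sub_cancel_left]
          · rw [across_across, (hTin f hf.opp).2, (hTacross f).2, k2, add_sub_cancel_left]
      · rw [hTout f hv, hTout f hv, hTout f hv, hf.crossing v (by simp)]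
    obtain ⟨a, h1, h2⟩ := hr (T f) g hf'
    exact ⟨a, hTconst f a h1, h2⟩

theorem rigidOff_moveTwo (h : MoveTwo D D') : RigidOff D ∅ A ↔ RigidOff D' ∅ A := by
  obtain ⟨d, h1, h2, h3, h4, he⟩ := h
  rw [rigidOff_bigon h1 h2 h3 h4]
  exact ⟨rigidOff_erasesTo he, rigidOff_of_erasesTo he⟩

/-! ### Sliding a strand over a crossing -/

/-- The four darts on the strand of `d` at the two ends of the edge of `d`. -/
def OnEdgeStrand (D : LinkDiagram) (d c : D.Dart) : Prop :=
  (c = d ∨ c = across d) ∨ (c = D.opp d ∨ c = across (D.opp d))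

theorem exchange_apply {d : D.Dart} (h : (D.opp d).1 ≠ d.1) :
    D.exchange d d = across (D.opp d) ∧ D.exchange d (across d) = D.opp d ∧
    D.exchange d (D.opp d) = across d ∧ D.exchange d (across (D.opp d)) = d := by
  have h1 : d ≠ across d := (across_ne d).symm
  have h2 : D.opp d ≠ across (D.opp d) := (across_ne _).symm
  have h3 : D.opp d ≠ d := D.opp_ne d
  have h4 : across (D.opp d) ≠ d := fun e => h (fst_congr e :)
  have h5 : D.opp d ≠ across d := fun e => h (fst_congr e :)
  have h6 : across (D.opp d) ≠ across d := fun e => h (fst_congr e :)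
  refine ⟨?_, ?_, ?_, ?_⟩ <;>
    simp [exchange, Equiv.swap_apply_of_ne_of_ne, h1, h2, h3, h6, h1.symm, h2.symm,
      h3.symm, h6.symm]

theorem exchange_apply_of_not {d c : D.Dart} (h : ¬ D.OnEdgeStrand d c) : D.exchange d c = c := by
  simp only [OnEdgeStrand, not_or] at h
  obtain ⟨⟨h1, h2⟩, h3, h4⟩ := h
  simp [exchange, Equiv.swap_apply_of_ne_of_ne, h1, h2, h3, h4]

theorem onEdgeStrand_exchange {d c : D.Dart} (h : (D.opp d).1 ≠ d.1) (hc : D.OnEdgeStrand d c) :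
    D.OnEdgeStrand d (D.exchange d c) := by
  obtain ⟨h1, h2, h3, h4⟩ := exchange_apply h
  rcases hc with (rfl | rfl) | (rfl | rfl)
  · rw [h1]; exact Or.inr (Or.inr rfl)
  · rw [h2]; exact Or.inr (Or.inl rfl)
  · rw [h3]; exact Or.inl (Or.inr rfl)
  · rw [h4]; exact Or.inl (Or.inl rfl)

theorem exchange_exchange {d c : D.Dart} (h : (D.opp d).1 ≠ d.1) (hc : D.OnEdgeStrand d c) :
    D.exchange d (D.exchange d c) = c := by
  obtain ⟨h1, h2, h3, h4⟩ := exchange_apply h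
  rcases hc with (rfl | rfl) | (rfl | rfl)
  · rw [h1, h4]
  · rw [h2, h3]
  · rw [h3, h2]
  · rw [h4, h1]

/-- A face with three sides and three distinct corners. -/
structure IsTriangle (D : LinkDiagram) (d : D.Dart) : Prop where
  closes : D.next (D.next (D.next d)) = d
  ne₀₁ : d.1 ≠ (D.next d).1
  ne₁₂ : (D.next d).1 ≠ (D.next (D.next d)).1
  ne₂₀ : (D.next (D.next d)).1 ≠ d.1

theorem IsTriangle.next {d : D.Dart} (h : D.IsTriangle d) : D.IsTriangle (D.next d) :=
  ⟨by rw [h.closes], h.ne₁₂, by rw [h.closes]; exact h.ne₂₀, by rw [h.closes]; exact h.ne₀₁⟩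

theorem IsTriangle.opp_ne {d : D.Dart} (h : D.IsTriangle d) : (D.opp d).1 ≠ d.1 := h.ne₀₁.symm

theorem ne_of_parity {x y : D.Dart} (h : IsOver x ↔ ¬ IsOver y) : x ≠ y := by
  rintro rfl
  tauto

/-- Consecutive sides meet at a corner on different strands, because `rot` changes the parity; any
other coincidence would identify two corners. Hence the three exchanges have disjoint supports. -/
theorem IsTriangle.not_onEdgeStrand {d c : D.Dart} (h : D.IsTriangle d)
    (hc : D.OnEdgeStrand d c) : ¬ D.OnEdgeStrand (D.next d) c := by
  have e1 : (D.next d).1 = (D.opp d).1 := rfl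
  have e2 : (D.next (D.next d)).1 = (D.opp (D.next d)).1 := rfl
  have h01 := h.ne₀₁
  have h12 := h.ne₁₂
  have h20 := h.ne₂₀
  have hp : IsOver (D.next d) ↔ ¬ IsOver (D.opp d) := isOver_rot _
  rintro ((rfl | rfl) | (rfl | rfl)) <;> rcases hc with (hc | hc) | (hc | hc)
  all_goals first
    | exact h01 (fst_congr hc :).symm
    | exact h20 (fst_congr hc :)
    | exact h12 (fst_congr hc :).symm
    | exact ne_of_parity (by simpa using hp) hc

/-- The permutation of darts in the third move. -/
noncomputable def slidePerm (D : LinkDiagram) (d : D.Dart) : Equiv.Perm D.Dart :=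
  D.exchange d * D.exchange (D.next d) * D.exchange (D.next (D.next d))

theorem IsTriangle.slidePerm_apply {d c : D.Dart} (h : D.IsTriangle d) :
    (D.OnEdgeStrand d c → D.slidePerm d c = D.exchange d c) ∧
    (D.OnEdgeStrand (D.next d) c → D.slidePerm d c = D.exchange (D.next d) c) ∧
    (D.OnEdgeStrand (D.next (D.next d)) c →
      D.slidePerm d c = D.exchange (D.next (D.next d)) c) := by
  simp only [slidePerm, Equiv.Perm.mul_apply]
  refine ⟨fun hc => ?_, fun hc => ?_, fun hc => ?_⟩
  · rw [exchange_apply_of_not (d := D.next (D.next d)), exchange_apply_of_not (d := D.next d)]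
    · exact h.not_onEdgeStrand hc
    · intro hc'
      have := h.next.next.not_onEdgeStrand hc'
      rw [h.closes] at this
      exact this hc
  · rw [exchange_apply_of_not (d := D.next (D.next d)), exchange_apply_of_not (d := d)]
    · exact fun hc' => h.not_onEdgeStrand hc' (onEdgeStrand_exchange h.next.opp_ne hc)
    · exact h.next.not_onEdgeStrand hc
  · have hc' := onEdgeStrand_exchange h.next.next.opp_ne hc
    rw [exchange_apply_of_not (d := D.next d), exchange_apply_of_not (d := d)]
    · have := h.next.next.not_onEdgeStrand hc'
      rwa [h.closes] at this
    · exact fun hc'' => h.next.not_onEdgeStrand hc'' hc'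

theorem slidePerm_apply_of_not {d c : D.Dart} (h₀ : ¬ D.OnEdgeStrand d c)
    (h₁ : ¬ D.OnEdgeStrand (D.next d) c) (h₂ : ¬ D.OnEdgeStrand (D.next (D.next d)) c) :
    D.slidePerm d c = c := by
  simp only [slidePerm, Equiv.Perm.mul_apply]
  rw [exchange_apply_of_not h₂, exchange_apply_of_not h₁, exchange_apply_of_not h₀]

theorem IsTriangle.slidePerm_slidePerm {d : D.Dart} (h : D.IsTriangle d) (c : D.Dart) :
    D.slidePerm d (D.slidePerm d c) = c := by
  by_cases h0 : D.OnEdgeStrand d c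
  · rw [h.slidePerm_apply.1 h0, h.slidePerm_apply.1 (onEdgeStrand_exchange h.opp_ne h0),
      exchange_exchange h.opp_ne h0]
  by_cases h1 : D.OnEdgeStrand (D.next d) c
  · rw [h.slidePerm_apply.2.1 h1, h.slidePerm_apply.2.1 (onEdgeStrand_exchange h.next.opp_ne h1),
      exchange_exchange h.next.opp_ne h1]
  by_cases h2 : D.OnEdgeStrand (D.next (D.next d)) c
  · rw [h.slidePerm_apply.2.2 h2,
      h.slidePerm_apply.2.2 (onEdgeStrand_exchange h.next.next.opp_ne h2),
      exchange_exchange h.next.next.opp_ne h2]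
  rw [slidePerm_apply_of_not h0 h1 h2, slidePerm_apply_of_not h0 h1 h2]

/-- The result of the third move at the triangle of `d`, on the same set of crossings. -/
noncomputable def slide (D : LinkDiagram) (d : D.Dart) : LinkDiagram where
  Crossing := D.Crossing
  finite_crossing := D.finite_crossing
  opp := fun c => (D.slidePerm d).symm (D.opp (D.slidePerm d c))
  opp_opp := fun c => by simp [D.opp_opp]
  opp_ne := fun c h => D.opp_ne (D.slidePerm d c) (by rwa [Equiv.symm_apply_eq] at h)
  circles := D.circles

theorem IsTriangle.slidePerm_symm {d : D.Dart} (h : D.IsTriangle d) (c : D.Dart) :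
    (D.slidePerm d).symm c = D.slidePerm d c := by
  rw [Equiv.symm_apply_eq, h.slidePerm_slidePerm]

theorem IsTriangle.slide_opp {d : D.Dart} (h : D.IsTriangle d) (c : D.Dart) :
    (D.slide d).opp c = D.slidePerm d (D.opp (D.slidePerm d c)) := h.slidePerm_symm _

-- Outer colors are carried along by the permutation of darts. Only the inner edges of the two lower
-- strands need new colors, and the crossings with the top strand dictate them.
open scoped Classical in
theorem rigidOff_of_slide {d : D.Dart} (h : D.IsTriangle d) (ho : IsOver d)
    (ho' : IsOver (D.opp d)) (hr : RigidOff (D.slide d) ∅ A) : RigidOff D ∅ A := by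
  intro f g hf
  obtain ⟨d₁, hd₁⟩ : ∃ c, c = D.next d := ⟨_, rfl⟩
  obtain ⟨d₂, hd₂⟩ : ∃ c, c = D.next d₁ := ⟨_, rfl⟩
  have hd₀ : D.next d₂ = d := by rw [hd₂, hd₁]; exact h.closes
  have ht₁ : D.IsTriangle d₁ := hd₁ ▸ h.next
  have ht₂ : D.IsTriangle d₂ := hd₂ ▸ ht₁.next
  have hp := fun c => h.slidePerm_apply (c := c)
  rw [← hd₁, ← hd₂] at hp
  obtain ⟨p, hpdef⟩ : ∃ p, p = D.slidePerm d := ⟨_, rfl⟩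
  have hpp : ∀ c, p (p c) = c := hpdef ▸ h.slidePerm_slidePerm
  have hslide : ∀ c, (D.slide d).opp c = p (D.opp (p c)) := hpdef ▸ h.slide_opp
  have hpn : ∀ c, ¬ D.OnEdgeStrand d c → ¬ D.OnEdgeStrand d₁ c →
      ¬ D.OnEdgeStrand d₂ c → p c = c := by
    rw [hpdef, hd₂, hd₁]
    exact fun c => slidePerm_apply_of_not
  rw [← hpdef] at hp
  have on₁ : ∀ e : D.Dart, D.OnEdgeStrand e e := fun e => Or.inl (Or.inl rfl)
  have on₂ : ∀ e : D.Dart, D.OnEdgeStrand e (across e) := fun e => Or.inl (Or.inr rfl)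
  have on₃ : ∀ e : D.Dart, D.OnEdgeStrand e (D.opp e) := fun e => Or.inr (Or.inl rfl)
  have on₄ : ∀ e : D.Dart, D.OnEdgeStrand e (across (D.opp e)) := fun e => Or.inr (Or.inr rfl)
  have p0 : p d = across (D.opp d) ∧ p (across d) = D.opp d ∧ p (D.opp d) = across d ∧
      p (across (D.opp d)) = d := by
    rw [(hp _).1 (on₁ d), (hp _).1 (on₂ d), (hp _).1 (on₃ d), (hp _).1 (on₄ d)]
    exact exchange_apply h.opp_ne
  have p1 : p d₁ = across (D.opp d₁) ∧ p (across d₁) = D.opp d₁ ∧ p (D.opp d₁) = across d₁ ∧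
      p (across (D.opp d₁)) = d₁ := by
    rw [(hp _).2.1 (on₁ _), (hp _).2.1 (on₂ _), (hp _).2.1 (on₃ _), (hp _).2.1 (on₄ _)]
    exact exchange_apply ht₁.opp_ne
  have p2 : p d₂ = across (D.opp d₂) ∧ p (across d₂) = D.opp d₂ ∧ p (D.opp d₂) = across d₂ ∧
      p (across (D.opp d₂)) = d₂ := by
    rw [(hp _).2.2 (on₁ _), (hp _).2.2 (on₂ _), (hp _).2.2 (on₃ _), (hp _).2.2 (on₄ _)]
    exact exchange_apply ht₂.opp_ne
  have v1 : (D.opp d).1 = d₁.1 := by rw [hd₁]; rfl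
  have v2 : (D.opp d₁).1 = d₂.1 := by rw [hd₂]; rfl
  have v0 : (D.opp d₂).1 = d.1 := by rw [← hd₀]; rfl
  have u1 : ¬ IsOver d₁ := by rw [hd₁]; exact fun h' => (isOver_rot _).1 h' ho'
  have u0 : ¬ IsOver (D.opp d₂) := by rw [← isOver_rot]; exact (congrArg IsOver hd₀).symm ▸ ho
  have hpar : IsOver d₂ ↔ ¬ IsOver (D.opp d₁) := by rw [hd₂]; exact isOver_rot _
  have n21 : ∀ x, D.OnEdgeStrand d₂ x → ¬ D.OnEdgeStrand d₁ x := fun x h2 h1 =>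
    ht₁.not_onEdgeStrand h1 (hd₂ ▸ h2)
  have n01 : ∀ x, D.OnEdgeStrand d x → ¬ D.OnEdgeStrand d₁ x := fun x h2 h1 =>
    h.not_onEdgeStrand h2 (hd₁ ▸ h1)
  have n02 : ∀ x, D.OnEdgeStrand d x → ¬ D.OnEdgeStrand d₂ x := fun x h0 h2 =>
    ht₂.not_onEdgeStrand h2 (hd₀.symm ▸ h0)
  let M₁ : D.Dart → Prop := fun c => c = across d₁ ∨ c = across (D.opp d₁)
  let M₂ : D.Dart → Prop := fun c => c = across d₂ ∨ c = across (D.opp d₂)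
  have on_of_M₁ : ∀ c, M₁ c → D.OnEdgeStrand d₁ c := by
    rintro c (rfl | rfl); exacts [on₂ _, on₄ _]
  have on_of_M₂ : ∀ c, M₂ c → D.OnEdgeStrand d₂ c := by
    rintro c (rfl | rfl); exacts [on₂ _, on₄ _]
  -- `M₁` and `M₂` are the new inner edges of the lower strands. Each meets the top strand next to
  -- the outer end that used to lie beyond the other corner, so it gets the reflection of that end's
  -- color in `f d`.
  let f' : D.Dart → A := fun c =>
    if M₁ c then f d + f d - f (across (D.opp d₁)) else
      if M₂ c then f d + f d - f (across d₂) else f (p c)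
  have f'M₁ : ∀ {c}, M₁ c → f' c = f d + f d - f (across (D.opp d₁)) := fun h => if_pos h
  have f'M₂ : ∀ {c}, M₂ c → f' c = f d + f d - f (across d₂) := fun h => by
    have := fun h' => n21 _ (on_of_M₂ _ h) (on_of_M₁ _ h')
    simp only [f', if_neg this, if_pos h]
  have f'N : ∀ {c}, ¬ M₁ c → ¬ M₂ c → f' c = f (p c) := fun h h' => by
    simp only [f', if_neg h, if_neg h']
  have f'0 : ∀ c, D.OnEdgeStrand d c → f' c = f (p c) := fun c hc =>
    f'N (fun h' => n01 _ hc (on_of_M₁ _ h')) (fun h' => n02 _ hc (on_of_M₂ _ h'))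
  have nM : ∀ {e : D.Dart}, (D.opp e).1 ≠ e.1 → ¬ (e = across e ∨ e = across (D.opp e)) ∧
      ¬ (D.opp e = across e ∨ D.opp e = across (D.opp e)) := fun {e} he => by
    refine ⟨?_, ?_⟩ <;> rintro (h' | h')
    · exact across_ne _ h'.symm
    · exact he (fst_congr h').symm
    · exact he (fst_congr h' :)
    · exact across_ne _ h'.symm
  have a1 : f (D.opp d) = f d := hf.opp d
  have a2 : f (across d) = f d := hf.across d (Or.inl ho)
  have a3 : f (across (D.opp d)) = f d := (hf.across _ (Or.inl ho')).trans a1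
  have b1 : f' d₁ = f (across (D.opp d₁)) := by
    rw [f'N (nM ht₁.opp_ne).1 (fun h' => n21 _ (on_of_M₂ _ h') (on₁ _)), p1.1]
  have b2 : f' (D.opp d₁) = f (across d₁) := by
    rw [f'N (nM ht₁.opp_ne).2 (fun h' => n21 _ (on_of_M₂ _ h') (on₃ _)), p1.2.2.1]
  have b3 : f' d₂ = f (across (D.opp d₂)) := by
    rw [f'N (fun h' => n21 _ (on₁ _) (on_of_M₁ _ h')) (nM ht₂.opp_ne).1, p2.1]
  have b4 : f' (D.opp d₂) = f (across d₂) := by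
    rw [f'N (fun h' => n21 _ (on₃ _) (on_of_M₁ _ h')) (nM ht₂.opp_ne).2, p2.2.2.1]
  have c1 : f' (across d₁) = f d + f d - f (across (D.opp d₁)) := f'M₁ (Or.inl rfl)
  have c2 : f' (across (D.opp d₁)) = f d + f d - f (across (D.opp d₁)) := f'M₁ (Or.inr rfl)
  have c3 : f' (across d₂) = f d + f d - f (across d₂) := f'M₂ (Or.inl rfl)
  have c4 : f' (across (D.opp d₂)) = f d + f d - f (across d₂) := f'M₂ (Or.inr rfl)
  have e1 : f' d = f d := by rw [f'0 _ (on₁ _), p0.1, a3]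
  have e2 : f' (across d) = f d := by rw [f'0 _ (on₂ _), p0.2.1, a1]
  have e3 : f' (D.opp d) = f d := by rw [f'0 _ (on₃ _), p0.2.2.1, a2]
  have e4 : f' (across (D.opp d)) = f d := by rw [f'0 _ (on₄ _), p0.2.2.2]
  have r1 : f d + f d = f d₁ + f (across d₁) := by
    rw [← hf.crossing' ho' u1 v1 (by simp), a1]
  have r0 : f d + f d = f d₂ + f (across (D.opp d₂)) := by
    rw [hf.crossing' ho u0 v0.symm (by simp), hf.opp]
  have i1 : f d₁ = f d + f d - f (across d₁) := by rw [r1, add_sub_cancel_right]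
  have i2 : f d₂ = f d + f d - f (across (D.opp d₂)) := by rw [r0, add_sub_cancel_right]
  -- Either of the two lower strands may be the upper one at their common crossing.
  have r2 : (IsOver (D.opp d₁) ∧ ¬ IsOver d₂ ∧ f (across (D.opp d₁)) = f d₁ ∧
      f d₁ + f d₁ = f d₂ + f (across d₂)) ∨
      (¬ IsOver (D.opp d₁) ∧ IsOver d₂ ∧ f (across d₂) = f d₂ ∧
        f d₂ + f d₂ = f d₁ + f (across (D.opp d₁))) := by
    by_cases hov : IsOver (D.opp d₁)
    · have hu : ¬ IsOver d₂ := fun h' => hpar.1 h' hov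
      refine Or.inl ⟨hov, hu, ?_, ?_⟩
      · rw [hf.across _ (Or.inl hov), hf.opp]
      · rw [← hf.crossing' hov hu v2 (by simp), hf.opp]
    · have hu : IsOver d₂ := hpar.2 hov
      refine Or.inr ⟨hov, hu, hf.across _ (Or.inl hu), ?_⟩
      rw [hf.crossing' hu hov v2.symm (by simp), hf.opp]
  have at0 : ∀ x : D.Dart, x.1 = d.1 → (x = d ∨ x = across d) ∨
      (x = D.opp d₂ ∨ x = across (D.opp d₂)) := fun x hx => by
    by_cases hxo : IsOver x
    · exact Or.inl (eq_or_eq_across hx (iff_of_true hxo ho))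
    · exact Or.inr (eq_or_eq_across (hx.trans v0.symm) (iff_of_false hxo u0))
  have at1 : ∀ x : D.Dart, x.1 = d₁.1 → (x = D.opp d ∨ x = across (D.opp d)) ∨
      (x = d₁ ∨ x = across d₁) := fun x hx => by
    by_cases hxo : IsOver x
    · exact Or.inl (eq_or_eq_across (hx.trans v1.symm) (iff_of_true hxo ho'))
    · exact Or.inr (eq_or_eq_across hx (iff_of_false hxo u1))
  have at2 : ∀ x : D.Dart, x.1 = d₂.1 → (x = D.opp d₁ ∨ x = across (D.opp d₁)) ∨
      (x = d₂ ∨ x = across d₂) := fun x hx => by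
    by_cases hxo : IsOver x ↔ IsOver d₂
    · exact Or.inr (eq_or_eq_across hx hxo)
    · exact Or.inl (eq_or_eq_across (hx.trans v2.symm) (iff_of_not_iff hxo hpar))
  have hnot : ∀ x : D.Dart, x.1 ≠ d.1 → x.1 ≠ d₁.1 → x.1 ≠ d₂.1 → f' x = f x := by
    intro x h0 h1 h2
    have k0 : ¬ D.OnEdgeStrand d x := by
      rintro ((rfl | rfl) | (rfl | rfl))
      exacts [h0 rfl, h0 rfl, h1 v1, h1 v1]
    have k1 : ¬ D.OnEdgeStrand d₁ x := by
      rintro ((rfl | rfl) | (rfl | rfl))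
      exacts [h1 rfl, h1 rfl, h2 v2, h2 v2]
    have k2 : ¬ D.OnEdgeStrand d₂ x := by
      rintro ((rfl | rfl) | (rfl | rfl))
      exacts [h2 rfl, h2 rfl, h0 v0, h0 v0]
    rw [f'N (fun h' => k1 (on_of_M₁ _ h')) (fun h' => k2 (on_of_M₂ _ h')), hpn x k0 k1 k2]
  have hM₁ : ∀ c, M₁ c → M₁ (p (D.opp (p c))) := by
    rintro c (rfl | rfl)
    · rw [p1.2.1, D.opp_opp, p1.1]; exact Or.inr rfl
    · rw [p1.2.2.2, p1.2.2.1]; exact Or.inl rfl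
  have hM₂ : ∀ c, M₂ c → M₂ (p (D.opp (p c))) := by
    rintro c (rfl | rfl)
    · rw [p2.2.1, D.opp_opp, p2.1]; exact Or.inr rfl
    · rw [p2.2.2.2, p2.2.2.1]; exact Or.inl rfl
  have hinv : ∀ c, p (D.opp (p (p (D.opp (p c))))) = c := fun c => by
    rw [hpp, D.opp_opp, hpp]
  have hf' : (D.slide d).IsColoringOff ∅ f' := by
    refine isColoringOff_of_darts (fun c => ?_) (fun c hc => ?_) (fun v _ => ?_)
    · rw [hslide]
      by_cases hc : M₁ c
      · rw [f'M₁ hc, f'M₁ (hM₁ c hc)]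
      by_cases hc' : M₂ c
      · rw [f'M₂ hc', f'M₂ (hM₂ c hc')]
      rw [f'N hc hc', f'N (fun h' => hc (hinv c ▸ hM₁ _ h')) (fun h' => hc' (hinv c ▸ hM₂ _ h')),
        hpp, hf.opp]
    · have hc : IsOver (D := D) c := hc.resolve_right (Set.notMem_empty _)
      change D.Dart at c
      change f' (across (D := D) c) = f' c
      have hx : ∀ {x y : D.Dart}, f' x = f' y → y = across x → c = x ∨ c = y →
          f' (across c) = f' c := by
        rintro x y h1 rfl (rfl | rfl)
        · exact h1.symm
        · rw [across_across]; exact h1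
      by_cases h0 : c.1 = d.1
      · rcases at0 c h0 with h' | h'
        · exact hx (e1.trans e2.symm) rfl h'
        · exact absurd hc (by rcases h' with rfl | rfl <;> simpa using u0)
      by_cases h1 : c.1 = d₁.1
      · rcases at1 c h1 with h' | h'
        · exact hx (e3.trans e4.symm) rfl h'
        · exact absurd hc (by rcases h' with rfl | rfl <;> simpa using u1)
      by_cases h2 : c.1 = d₂.1
      · rcases r2 with ⟨k1, k2, k3, k4⟩ | ⟨k1, k2, k3, k4⟩ <;> rcases at2 c h2 with h' | h'
        · refine hx ?_ rfl h'
          rw [b2, c2, k3, r1, add_sub_cancel_left]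
        · exact absurd hc (by rcases h' with rfl | rfl <;> simpa using k2)
        · exact absurd hc (by rcases h' with rfl | rfl <;> simpa using k1)
        · refine hx ?_ rfl h'
          rw [b3, c3, k3, r0, add_sub_cancel_left]
      rw [hnot c h0 h1 h2, hnot (across c) h0 h1 h2, hf.across c (Or.inl hc)]
    · change D.Crossing at v
      change ∃ b u : D.Dart, b.1 = v ∧ u.1 = v ∧ IsOver b ∧ ¬ IsOver u ∧
        f' b + f' b = f' u + f' (across u)
      by_cases h0 : v = d.1
      · refine ⟨d, D.opp d₂, h0.symm, v0.trans h0.symm, ho, u0, ?_⟩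
        rw [e1, b4, c4, add_sub_cancel]
      by_cases h1 : v = d₁.1
      · refine ⟨D.opp d, d₁, v1.trans h1.symm, h1.symm, ho', u1, ?_⟩
        rw [e3, b1, c1, add_sub_cancel]
      by_cases h2 : v = d₂.1
      -- In both cases the new relation is the old one with all its colors reflected in `f d`.
      · rcases r2 with ⟨k1, k2, k3, k4⟩ | ⟨k1, k2, k3, k4⟩
        · refine ⟨D.opp d₁, d₂, v2.trans h2.symm, h2.symm, k1, k2, ?_⟩
          rw [b2, b3, c3]
          rw [← sub_eq_iff_eq_add'] at r1 r0 k4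
          rw [← r1, ← r0, ← k4]
          abel
        · refine ⟨d₂, D.opp d₁, h2.symm, v2.trans h2.symm, k2, k1, ?_⟩
          rw [b2, b3, c2]
          rw [← sub_eq_iff_eq_add'] at r1 r0 k4
          rw [← r1, ← r0, ← k4]
          abel
      · refine ⟨(v, 1), (v, 0), rfl, rfl, Or.inl rfl, by rw [not_isOver_iff]; simp, ?_⟩
        have e : across ((v, 0) : D.Dart) = (v, 2) := by simp [across]
        rw [e, hnot _ h0 h1 h2, hnot _ h0 h1 h2, hnot _ h0 h1 h2, hf.crossing v (by simp)]
  obtain ⟨a, h1, h2⟩ := hr f' g hf'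
  have h1 : ∀ c : D.Dart, f' c = a := h1
  refine ⟨a, fun c => ?_, h2⟩
  have hd : f d = a := e1.symm.trans (h1 _)
  -- The old inner edges are not seen by `f'`; their colors are reflections of outer ones.
  have hd1 : f d₁ = a := by rw [i1, hd, ← b2, h1, add_sub_cancel_right]
  have hd2 : f d₂ = a := by rw [i2, hd, ← b3, h1, add_sub_cancel_right]
  by_cases hc : M₁ (p c)
  · have hc' : c = D.opp d₁ ∨ c = d₁ := by
      rcases hc with hc | hc
      · left; rw [← hpp c, hc, p1.2.1]
      · right; rw [← hpp c, hc, p1.2.2.2]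
    rcases hc' with rfl | rfl
    · rw [hf.opp, hd1]
    · exact hd1
  by_cases hc' : M₂ (p c)
  · have hc' : c = D.opp d₂ ∨ c = d₂ := by
      rcases hc' with hc | hc
      · left; rw [← hpp c, hc, p2.2.1]
      · right; rw [← hpp c, hc, p2.2.2.2]
    rcases hc' with rfl | rfl
    · rw [hf.opp, hd2]
    · exact hd2
  rw [← h1 (p c), f'N hc hc', hpp]

/-- After the move the triangle occupies the opposite corners of the same three crossings, so its
sides join the `across` darts. -/
theorem IsTriangle.slide_opp_across {d : D.Dart} (h : D.IsTriangle d) :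
    (D.slide d).opp (across (D := D) d) = across (D := D) (D.opp d) := by
  rw [h.slide_opp, h.slidePerm_apply.1 (Or.inl (Or.inr rfl)), (exchange_apply h.opp_ne).2.1,
    D.opp_opp, h.slidePerm_apply.1 (Or.inl (Or.inl rfl)), (exchange_apply h.opp_ne).1]

theorem IsTriangle.slide_next {d : D.Dart} (h : D.IsTriangle d) :
    (D.slide d).next (across (D := D) d) = across (D := D) (D.next d) := by
  refine (congrArg rot h.slide_opp_across).trans ?_
  exact (across_rot (D := D) _).symm

theorem IsTriangle.slide_opp_across' {d : D.Dart} (h : D.IsTriangle d) :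
    (D.slide d).opp (across (D := D) (D.next d)) = across (D := D) (D.opp (D.next d)) := by
  rw [h.slide_opp, h.slidePerm_apply.2.1 (Or.inl (Or.inr rfl)), (exchange_apply h.next.opp_ne).2.1,
    D.opp_opp, h.slidePerm_apply.2.1 (Or.inl (Or.inl rfl)), (exchange_apply h.next.opp_ne).1]

theorem IsTriangle.slide_opp_across'' {d : D.Dart} (h : D.IsTriangle d) :
    (D.slide d).opp (across (D := D) (D.next (D.next d))) =
      across (D := D) (D.opp (D.next (D.next d))) := by
  rw [h.slide_opp, h.slidePerm_apply.2.2 (Or.inl (Or.inr rfl)),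
    (exchange_apply h.next.next.opp_ne).2.1, D.opp_opp,
    h.slidePerm_apply.2.2 (Or.inl (Or.inl rfl)), (exchange_apply h.next.next.opp_ne).1]

theorem IsTriangle.slide_next' {d : D.Dart} (h : D.IsTriangle d) :
    (D.slide d).next (across (D := D) (D.next d)) = across (D := D) (D.next (D.next d)) := by
  refine (congrArg rot h.slide_opp_across').trans ?_
  exact (across_rot (D := D) _).symm

theorem IsTriangle.slide_next'' {d : D.Dart} (h : D.IsTriangle d) :
    (D.slide d).next (across (D := D) (D.next (D.next d))) = across (D := D) d := by
  refine (congrArg rot h.slide_opp_across'').trans ?_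
  refine (across_rot (D := D) _).symm.trans (congrArg across ?_)
  exact h.closes

theorem IsTriangle.slide {d : D.Dart} (h : D.IsTriangle d) :
    (D.slide d).IsTriangle (across (D := D) d) := by
  constructor
  · rw [h.slide_next, h.slide_next', h.slide_next'']
  · rw [h.slide_next]; exact h.ne₀₁
  · rw [h.slide_next, h.slide_next']; exact h.ne₁₂
  · rw [h.slide_next, h.slide_next']; exact h.ne₂₀

open scoped Classical in
theorem exchange_slide {d e : D.Dart} (he : (D.opp e).1 ≠ e.1)
    (h : (D.slide d).opp (across (D := D) e) = across (D := D) (D.opp e)) :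
    (D.slide d).exchange (across (D := D) e) = D.exchange e := by
  have h1 : across (D := D.slide d) (across (D := D) e) = e := across_across (D := D) e
  have h2 : across (D := D.slide d) (across (D := D) (D.opp e)) = D.opp e :=
    across_across (D := D) _
  unfold exchange
  rw [h, h1, h2]
  change Equiv.swap (across e) (D.opp e) * Equiv.swap e (across (D.opp e)) = _
  refine (Equiv.Perm.disjoint_swap_swap ?_).commute.eq
  have h1 : d ≠ across d := (across_ne d).symm
  have h2 : D.opp e ≠ across (D.opp e) := (across_ne _).symm
  have h3 : D.opp e ≠ e := D.opp_ne e
  have h4 : across (D.opp e) ≠ e := fun x => he (fst_congr x :)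
  have h5 : D.opp e ≠ across e := fun x => he (fst_congr x :)
  have h6 : across (D.opp e) ≠ across e := fun x => he (fst_congr x :)
  simp [across_ne, h2, h3, h4.symm, h5.symm, h6.symm]

theorem IsTriangle.slidePerm_slide {d : D.Dart} (h : D.IsTriangle d) :
    (D.slide d).slidePerm (across (D := D) d) = D.slidePerm d := by
  unfold slidePerm
  rw [h.slide_next, h.slide_next', exchange_slide h.opp_ne h.slide_opp_across,
    exchange_slide h.next.opp_ne h.slide_opp_across',
    exchange_slide h.next.next.opp_ne h.slide_opp_across'']
  rfl

/-- The permutation attached to the new triangle is the old one, which is an involution. So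
invariance in one direction gives the other. -/
theorem IsTriangle.slide_slide {d : D.Dart} (h : D.IsTriangle d) :
    (D.slide d).slide (across (D := D) d) = D := by
  have : ((D.slide d).slide (across (D := D) d)).opp = D.opp := by
    funext c
    have e1 := h.slide.slide_opp c
    rw [h.slidePerm_slide] at e1
    refine e1.trans ((congrArg (D.slidePerm d) (h.slide_opp _)).trans ?_)
    exact (h.slidePerm_slidePerm _).trans (congrArg D.opp (h.slidePerm_slidePerm _))
  cases D
  simp only [LinkDiagram.slide] at this ⊢
  congr

theorem rigidOff_slide {d : D.Dart} (h : D.IsTriangle d) (ho : IsOver d) (ho' : IsOver (D.opp d)) :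
    RigidOff D ∅ A ↔ RigidOff (D.slide d) ∅ A := by
  refine ⟨fun hr => ?_, rigidOff_of_slide h ho ho'⟩
  have ho₁ : IsOver (D := D.slide d) (across (D := D) d) := (isOver_across d).2 ho
  refine rigidOff_of_slide h.slide ho₁ ?_ ?_
  · rw [h.slide_opp_across]; exact (isOver_across (D := D) _).2 ho'
  · rwa [h.slide_slide]

theorem rigidOff_moveThree (h : MoveThree D D') : RigidOff D ∅ A ↔ RigidOff D' ∅ A := by
  obtain ⟨d, h1, h2, h3, h4, ho, ho', e, hc, hopp⟩ := h
  have ht : D.IsTriangle d := ⟨h1, h2, h3, h4⟩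
  have hi : Iso (D.slide d) D' := by
    refine ⟨e, fun _ => 0, fun _ => Or.inl rfl, fun c => ?_, hc⟩
    simp only [add_zero]
    have h5 := hopp c
    have h6 := ht.slide_opp c
    refine h5.trans ?_
    exact (congrArg (fun x : D.Dart => (e x.1, x.2)) h6).symm
  rw [rigidOff_slide ht ho ho']
  exact ⟨rigidOff_iso hi.symm, rigidOff_iso hi⟩

/-! ### Link invariance of rigidity -/

theorem rigidOff_step (h : Step D D') : RigidOff D ∅ A ↔ RigidOff D' ∅ A := by
  obtain ⟨_, _, h | h | h | h⟩ := h
  · exact ⟨rigidOff_iso h.symm, rigidOff_iso h⟩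
  · exact rigidOff_moveOne h
  · exact rigidOff_moveTwo h
  · exact rigidOff_moveThree h

/-- Whether all colorings are constant depends on the link only. -/
theorem SameLink.rigidOff_iff (h : D.SameLink D') : RigidOff D ∅ A ↔ RigidOff D' ∅ A := by
  induction h with
  | rel _ _ h => exact rigidOff_step h
  | refl => rfl
  | symm _ _ _ ih => exact ih.symm
  | trans _ _ _ _ _ ih₁ ih₂ => exact ih₁.trans ih₂

theorem rigidOff_unknot : RigidOff unknot ∅ A := fun _ g _ =>
  ⟨g (0 : Fin 1), fun d => d.1.elim, fun _ => congrArg g (Subsingleton.elim (α := Fin 1) _ _)⟩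

end Colorings

variable {D D' : LinkDiagram}

/-! ### Arcs of alternating diagrams and relations between them -/

theorem arc_opp (d : D.Dart) : D.arc (D.opp d) = D.arc d :=
  congrArg Sum.inl (Quot.sound (r := fun d e : D.Dart => e = D.opp d ∨ (IsOver d ∧ e = across d))
    (Or.inl rfl)).symm

theorem arc_across {d : D.Dart} (h : IsOver d) : D.arc (across d) = D.arc d :=
  congrArg Sum.inl (Quot.sound (r := fun d e : D.Dart => e = D.opp d ∨ (IsOver d ∧ e = across d))
    (Or.inr ⟨h, rfl⟩)).symm

theorem arc_eq_of_isOver {d : D.Dart} (h : IsOver d) : D.arc d = D.arc (d.1, 1) := by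
  rcases eq_or_eq_across (d := d) (e := (d.1, 1)) rfl (iff_of_true h (Or.inl rfl)) with h' | h'
  · rw [← h']
  · rw [h', arc_across (Or.inl rfl)]; rfl

open scoped Classical in
/-- The crossing at which the arc of a dart passes over. -/
noncomputable def owner (d : D.Dart) : D.Crossing := if IsOver d then d.1 else (D.opp d).1

theorem owner_of_isOver {d : D.Dart} (h : IsOver d) : owner d = d.1 := if_pos h

theorem owner_opp (ha : D.Alternating) (d : D.Dart) : owner (D.opp d) = owner d := by
  by_cases h : IsOver d
  · have h' : ¬ IsOver (D.opp d) := fun h' => (ha d).1 h' h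
    simp only [owner, if_pos h, if_neg h', D.opp_opp]
  · have h' : IsOver (D.opp d) := (ha d).2 h
    simp only [owner, if_neg h, if_pos h']

theorem owner_eq_of_arc_eq (ha : D.Alternating) {d e : D.Dart} (h : D.arc d = D.arc e) :
    owner d = owner e := by
  let F : Quot (fun d e : D.Dart => e = D.opp d ∨ (IsOver d ∧ e = across d)) → D.Crossing :=
    Quot.lift owner (by
      rintro a b (rfl | ⟨h, rfl⟩)
      · exact (owner_opp ha a).symm
      · rw [owner_of_isOver h, owner_of_isOver ((isOver_across a).2 h)]; rfl)
  exact congrArg F (Sum.inl_injective h)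

/-- By alternation an arc has a single overpass, so `owner` is well defined on arcs and `v ↦ D.arc
(v, 1)` indexes them by crossings. -/
theorem arc_eq_iff (ha : D.Alternating) {d e : D.Dart} (hd : IsOver d) (he : IsOver e) :
    D.arc d = D.arc e ↔ d.1 = e.1 := by
  refine ⟨fun h => ?_, fun h => ?_⟩
  · have := owner_eq_of_arc_eq ha h
    rwa [owner_of_isOver hd, owner_of_isOver he] at this
  · rw [arc_eq_of_isOver hd, arc_eq_of_isOver he, h]

theorem exists_arc_eq (ha : D.Alternating) (hc : D.circles = 0) (a : D.Arc) :
    ∃ v : D.Crossing, a = D.arc (v, 1) := by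
  rcases a with q | i
  · obtain ⟨d, rfl⟩ := Quot.exists_rep q
    by_cases hd : IsOver d
    · exact ⟨_, arc_eq_of_isOver hd⟩
    · exact ⟨_, (arc_opp d).symm.trans (arc_eq_of_isOver ((ha d).2 hd))⟩
  · rw [hc] at i
    exact i.elim0

theorem isColoringOff_gen (D : LinkDiagram) :
    D.IsColoringOff ∅ (fun d => D.gen (D.arc d)) := by
  refine ⟨fun d => by rw [arc_opp], fun d hd => ?_, fun v _ => ?_⟩
  · rw [arc_across (by simpa using hd)]
  · have h : (QuotientAddGroup.mk (D.relator v) : D.Col) = 0 :=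
      (QuotientAddGroup.eq_zero_iff _).2 (AddSubgroup.subset_closure ⟨v, rfl⟩)
    rw [← sub_eq_zero, ← h, relator, two_nsmul, sub_sub]
    rfl

-- The arc over `u` ends as an under-arc at the crossings that follow `(u, 1)` and `(u, 3)`. Thus,
-- read in `u` for fixed `v`, the relation matrix acts as a Laplacian along over-strands. The case
-- distinction covers ends that arrive at the same crossing.
open scoped Classical in
theorem relator_apply (ha : D.Alternating) (u v : D.Crossing) :
    D.relator v (D.arc (u, 1)) = 2 * (Pi.single v 1 : D.Crossing → ℤ) u
      - (Pi.single v 1 : D.Crossing → ℤ) (D.opp (u, 1)).1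
      - (Pi.single v 1 : D.Crossing → ℤ) (D.opp (u, 3)).1 := by
  have o1 : ∀ w : D.Crossing, IsOver ((w, 1) : D.Dart) := fun w => Or.inl rfl
  have o3 : ∀ w : D.Crossing, IsOver ((w, 3) : D.Dart) := fun w => Or.inr rfl
  have n0 : ¬ IsOver ((v, 0) : D.Dart) := by rw [not_isOver_iff]; exact Or.inl rfl
  have n2 : ¬ IsOver ((v, 2) : D.Dart) := by rw [not_isOver_iff]; exact Or.inr rfl
  have h1 : D.arc (v, 1) = D.arc (u, 1) ↔ u = v :=
    (arc_eq_iff ha (o1 v) (o1 u)).trans eq_comm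
  have hunder : ∀ e : D.Dart, ¬ IsOver e → (D.arc e = D.arc (u, 1) ↔
      D.opp (u, 1) = e ∨ D.opp (u, 3) = e) := fun e he => by
    rw [← arc_opp e, arc_eq_iff ha ((ha e).2 he) (o1 u), opp_eq_iff, opp_eq_iff]
    refine ⟨fun h => ?_, ?_⟩
    · rcases eq_or_eq_across h (iff_of_true ((ha e).2 he) (o1 u)) with h' | h'
      · exact Or.inl h'.symm
      · exact Or.inr h'.symm
    · rintro (h | h) <;> rw [← h]
  have hover : ∀ e : D.Dart, IsOver e → ((D.opp e).1 = v ↔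
      D.opp e = (v, 0) ∨ D.opp e = (v, 2)) := fun e he => by
    have he' : ¬ IsOver (D.opp e) := fun h => (ha e).1 h he
    refine ⟨fun h => ?_, ?_⟩
    · exact eq_or_eq_across (e := (v, 0)) h (iff_of_false he' n0) |>.imp id fun h' => by
        rw [h']; simp [across]
    · rintro (h | h) <;> rw [h]
  have hne : (u, (1 : ZMod 4)) ≠ (u, 3) := by
    simp; decide
  have hne' : D.opp (u, 1) ≠ D.opp (u, 3) := fun h => hne (D.opp_injective h)
  have hne02 : (v, (0 : ZMod 4)) ≠ (v, 2) := by
    simp; decide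
  simp only [relator, Finsupp.sub_apply, Finsupp.smul_apply, Finsupp.single_apply, Pi.single_apply,
    h1, hunder _ n0, hunder _ n2, hover _ (o1 u), hover _ (o3 u), nsmul_eq_mul]
  generalize D.opp (u, 1) = a at *
  generalize D.opp (u, 3) = b at *
  by_cases a0 : a = (v, 0)
  · subst a0
    by_cases b2 : b = (v, 2)
    · subst b2; simp [hne02, hne02.symm]
    · simp [hne02, hne'.symm, b2]
  · by_cases b2 : b = (v, 2)
    · subst b2; simp [hne02.symm, hne', a0]
    · by_cases a2 : a = (v, 2)
      · subst a2
        by_cases b0 : b = (v, 0)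
        · subst b0; simp [hne02, hne02.symm]
        · simp [hne02.symm, b0, b2]
      · by_cases b0 : b = (v, 0)
        · subst b0; simp [hne02, a0, a2]
        · simp [a0, a2, b0, b2]

/-- The potential counts how often each crossing's relator occurs in `w`. -/
theorem exists_potential (ha : D.Alternating) {w : D.Arc →₀ ℤ}
    (hw : w ∈ AddSubgroup.closure (Set.range D.relator)) :
    ∃ c : D.Crossing → ℤ, ∀ u,
      w (D.arc (u, 1)) = 2 * c u - c (D.opp (u, 1)).1 - c (D.opp (u, 3)).1 := by
  classical
  induction hw using AddSubgroup.closure_induction with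
  | mem x hx =>
    obtain ⟨v, rfl⟩ := hx
    exact ⟨Pi.single v 1, fun u => relator_apply ha u v⟩
  | zero => exact ⟨0, fun u => by simp⟩
  | add x y _ _ hx hy =>
    obtain ⟨c, hc⟩ := hx
    obtain ⟨c', hc'⟩ := hy
    refine ⟨c + c', fun u => ?_⟩
    rw [Finsupp.add_apply, hc, hc']
    simp only [Pi.add_apply]
    ring
  | neg x _ hx =>
    obtain ⟨c, hc⟩ := hx
    refine ⟨-c, fun u => ?_⟩
    rw [Finsupp.neg_apply, hc]
    simp only [Pi.neg_apply]
    ring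

/-! ### Cuts -/

/-- The over-darts in `S` whose edges leave `S`. -/
def overBoundary (D : LinkDiagram) (S : Set D.Crossing) : Set D.Dart :=
  {d | IsOver d ∧ d.1 ∈ S ∧ (D.opp d).1 ∉ S}

/-- The under-darts in `S` whose edges leave `S`. -/
def underBoundary (D : LinkDiagram) (S : Set D.Crossing) : Set D.Dart :=
  {d | ¬ IsOver d ∧ d.1 ∈ S ∧ (D.opp d).1 ∉ S}

/-- The underlying graph is connected. -/
def GraphConnected (D : LinkDiagram) : Prop :=
  ∀ S : Set D.Crossing, S.Nonempty → (∀ d : D.Dart, d.1 ∈ S → (D.opp d).1 ∈ S) → S = Set.univ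

theorem finite_dart (D : LinkDiagram) : Finite D.Dart := by
  have := D.finite_crossing
  exact Finite.instProd

/-- `S` contains as many over-darts as under-darts, and each edge inside `S` uses one of each. -/
theorem ncard_overBoundary (ha : D.Alternating) (S : Set D.Crossing) :
    (D.overBoundary S).ncard = (D.underBoundary S).ncard := by
  have := D.finite_dart
  let I : Set D.Dart := {d | IsOver d ∧ d.1 ∈ S ∧ (D.opp d).1 ∈ S}
  let J : Set D.Dart := {d | ¬ IsOver d ∧ d.1 ∈ S ∧ (D.opp d).1 ∈ S}
  have hIJ : D.opp '' I = J := by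
    ext d
    constructor
    · rintro ⟨e, ⟨h1, h2, h3⟩, rfl⟩
      exact ⟨fun h => (ha e).1 h h1, h3, by rwa [D.opp_opp]⟩
    · rintro ⟨h1, h2, h3⟩
      exact ⟨D.opp d, ⟨(ha d).2 h1, h3, by rwa [D.opp_opp]⟩, D.opp_opp d⟩
  have hrot : rot '' (D.overBoundary S ∪ I) = D.underBoundary S ∪ J := by
    have e1 : D.overBoundary S ∪ I = {d | IsOver d ∧ d.1 ∈ S} := by
      ext d; simp only [overBoundary, I, Set.mem_union, Set.mem_ofPred_eq]; tauto
    have e2 : D.underBoundary S ∪ J = {d | ¬ IsOver d ∧ d.1 ∈ S} := by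
      ext d; simp only [underBoundary, J, Set.mem_union, Set.mem_ofPred_eq]; tauto
    rw [e1, e2]
    ext d
    constructor
    · rintro ⟨e, ⟨h1, h2⟩, rfl⟩
      exact ⟨fun h => (isOver_rot e).1 h h1, h2⟩
    · rintro ⟨h1, h2⟩
      have e : rot ((d.1, d.2 - 1) : D.Dart) = d := Prod.ext rfl (sub_add_cancel _ _)
      refine ⟨(d.1, d.2 - 1), ⟨?_, h2⟩, e⟩
      by_contra h
      exact h1 (e ▸ (isOver_rot _).2 h)
  have c1 : (D.overBoundary S ∪ I).ncard = (D.overBoundary S).ncard + I.ncard :=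
    Set.ncard_union_eq (Set.disjoint_left.2 fun d h1 h2 => h1.2.2 h2.2.2)
  have c2 : (D.underBoundary S ∪ J).ncard = (D.underBoundary S).ncard + J.ncard :=
    Set.ncard_union_eq (Set.disjoint_left.2 fun d h1 h2 => h1.2.2 h2.2.2)
  rw [← hrot, Set.ncard_image_of_injective _ rot_injective, c1, ← hIJ,
    Set.ncard_image_of_injective _ D.opp_injective] at c2
  omega

theorem ncard_overBoundary_compl (ha : D.Alternating) (S : Set D.Crossing) :
    (D.overBoundary Sᶜ).ncard = (D.overBoundary S).ncard := by
  have : D.overBoundary Sᶜ = D.opp '' D.underBoundary S := by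
    ext d
    constructor
    · rintro ⟨h1, h2, h3⟩
      exact ⟨D.opp d, ⟨fun h => (ha d).1 h h1, by simpa using h3, by rwa [D.opp_opp]⟩, D.opp_opp d⟩
    · rintro ⟨e, ⟨h1, h2, h3⟩, rfl⟩
      exact ⟨(ha e).2 h1, h3, by simpa [D.opp_opp] using h2⟩
  rw [this, Set.ncard_image_of_injective _ D.opp_injective, ncard_overBoundary ha]

theorem one_le_ncard_overBoundary (ha : D.Alternating) (hconn : D.GraphConnected)
    {S : Set D.Crossing} (hS : S.Nonempty) (hS' : S ≠ Set.univ) :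
    1 ≤ (D.overBoundary S).ncard := by
  have := D.finite_dart
  by_contra! h
  have h1 : (D.overBoundary S).ncard = 0 := by omega
  have h2 : (D.underBoundary S).ncard = 0 := by rw [← ncard_overBoundary ha, h1]
  rw [Set.ncard_eq_zero] at h1 h2
  refine hS' (hconn S hS fun d hd => ?_)
  by_contra hd'
  by_cases ho : IsOver d
  · exact Set.eq_empty_iff_forall_notMem.1 h1 d ⟨ho, hd, hd'⟩
  · exact Set.eq_empty_iff_forall_notMem.1 h2 d ⟨ho, hd, hd'⟩

/-- Submodularity of the cut function: a dart leaving `S ∩ T` or `S ∪ T` leaves `S` or `T`, and one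
leaving both of the former leaves both of the latter. -/
theorem ncard_overBoundary_inter_add_union (S T : Set D.Crossing) :
    (D.overBoundary (S ∩ T)).ncard + (D.overBoundary (S ∪ T)).ncard ≤
      (D.overBoundary S).ncard + (D.overBoundary T).ncard := by
  have := D.finite_dart
  rw [← Set.ncard_union_add_ncard_inter (D.overBoundary (S ∩ T)),
    ← Set.ncard_union_add_ncard_inter (D.overBoundary S)]
  refine add_le_add (Set.ncard_le_ncard ?_) (Set.ncard_le_ncard ?_)
  · intro d
    simp only [overBoundary, Set.mem_union, Set.mem_ofPred_eq, Set.mem_inter_iff]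
    tauto
  · intro d
    simp only [overBoundary, Set.mem_union, Set.mem_ofPred_eq, Set.mem_inter_iff]
    tauto

/-- A set of crossings which is separated from its complement by two edges. -/
structure IsCut (D : LinkDiagram) (S : Set D.Crossing) : Prop where
  nonempty : S.Nonempty
  ne_univ : S ≠ Set.univ
  ncard_le : (D.overBoundary S).ncard ≤ 1

/-- The set where an integral potential of `x - y` is maximal is a cut between `x` and `y`. -/
theorem exists_cut_of_gen_eq (ha : D.Alternating) (hconn : D.GraphConnected) {x y : D.Crossing}
    (hxy : x ≠ y) (h : D.gen (D.arc (x, 1)) = D.gen (D.arc (y, 1))) :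
    ∃ S, D.IsCut S ∧ x ∈ S ∧ y ∉ S := by
  classical
  have := D.finite_crossing
  have := D.finite_dart
  have hw := (QuotientAddGroup.eq (s := AddSubgroup.closure (Set.range D.relator))).1 h.symm
  obtain ⟨c, hc⟩ := exists_potential ha hw
  have hval : ∀ u, (-Finsupp.single (D.arc (y, 1)) 1 + Finsupp.single (D.arc (x, 1)) 1 : D.Arc →₀ ℤ)
      (D.arc (u, 1)) = (if u = x then 1 else 0) - (if u = y then 1 else 0) := fun u => by
    have hx : D.arc (x, 1) = D.arc (u, 1) ↔ u = x :=
      (arc_eq_iff ha (Or.inl rfl) (Or.inl rfl)).trans eq_comm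
    have hy : D.arc (y, 1) = D.arc (u, 1) ↔ u = y :=
      (arc_eq_iff ha (Or.inl rfl) (Or.inl rfl)).trans eq_comm
    rw [Finsupp.add_apply, Finsupp.neg_apply, Finsupp.single_apply, Finsupp.single_apply]
    simp only [hx, hy]
    ring
  have hc' : ∀ d : D.Dart, IsOver d → c (D.opp d).1 + c (D.opp (across d)).1 =
      2 * c d.1 - (if d.1 = x then 1 else 0) + (if d.1 = y then 1 else 0) := by
    rintro ⟨u, i⟩ hd
    have h1 := (hval u).symm.trans (hc u)
    have z : (3 : ZMod 4) + 2 = 1 := by decide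
    have z' : (1 : ZMod 4) + 2 = 3 := by decide
    rcases hd with rfl | rfl
    · simp only [across, z']; linarith
    · simp only [across, z]; linarith
  have : Nonempty D.Crossing := ⟨x⟩
  obtain ⟨m, hm⟩ := Finite.exists_max c
  let S : Set D.Crossing := {u | c u = c m}
  have hSm : m ∈ S := rfl
  have hlt : ∀ u, u ∉ S → c u ≤ c m - 1 := fun u hu => by
    have := lt_of_le_of_ne (hm u) hu
    omega
  -- At `y` the two neighboring values sum to `2 * c y + 1`, impossible at a maximum.
  have hyS : y ∉ S := fun hy => by
    have h1 := hc' (y, 1) (Or.inl rfl)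
    have hy : c y = c m := hy
    simp only [if_neg hxy.symm, if_true, hy] at h1
    have h2 := hm (D.opp (y, 1)).1
    have h3 := hm (D.opp (across (y, 1))).1
    omega
  -- At a maximum other than `x` both neighbors are maximal. At `x` the deficit is `1`, so exactly
  -- one neighbor drops, by `1`.
  have hbd : ∀ d ∈ D.overBoundary S, d.1 = x ∧ (D.opp (across d)).1 ∈ S := by
    rintro d ⟨ho, hd, hd'⟩
    have h1 := hc' d ho
    have hd : c d.1 = c m := hd
    have h2 := hlt _ hd'
    have h3 := hm (D.opp (across d)).1
    have hy : d.1 ≠ y := fun h => hyS (h ▸ hd)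
    rw [if_neg hy, hd] at h1
    by_cases hx : d.1 = x
    · rw [if_pos hx] at h1
      refine ⟨hx, ?_⟩
      change c _ = c m
      omega
    · rw [if_neg hx] at h1
      omega
  have hne : S ≠ Set.univ := fun h => hyS (h ▸ Set.mem_univ y)
  refine ⟨S, ⟨⟨m, hSm⟩, hne, ?_⟩, ?_, hyS⟩
  · rw [Set.ncard_le_one]
    intro d hd e he
    rcases eq_or_eq_across ((hbd d hd).1.trans (hbd e he).1.symm) (iff_of_true hd.1 he.1) with h | h
    · exact h
    · exact absurd (hbd e he).2 (h ▸ hd.2.2)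
  · have h1 := one_le_ncard_overBoundary ha hconn ⟨m, hSm⟩ hne
    obtain ⟨d, hd⟩ := (Set.ncard_pos).1 h1
    have := hd.2.1
    rwa [(hbd d hd).1] at this

theorem IsCut.compl (ha : D.Alternating) {S : Set D.Crossing} (h : D.IsCut S) : D.IsCut Sᶜ :=
  ⟨Set.nonempty_compl.2 h.ne_univ, fun h' => h.nonempty.ne_empty (by simpa using h'),
    (ncard_overBoundary_compl ha S).trans_le h.ncard_le⟩

/-- A connected alternating diagram without loops has a non-constant coloring. -/
theorem not_rigidOff (ha : D.Alternating) (hconn : D.GraphConnected)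
    (hloop : ∀ d : D.Dart, (D.opp d).1 ≠ d.1) (hne : Nonempty D.Crossing) :
    ∃ A : Type, ∃ _ : AddCommGroup A, ¬ RigidOff D ∅ A := by
  have := D.finite_crossing
  have := D.finite_dart
  -- The universal coloring: if it is constant, all generators agree and every pair of crossings is
  -- separated by a cut.
  refine ⟨D.Col, inferInstance, fun hr => ?_⟩
  obtain ⟨g, hg, -⟩ := hr _ (fun _ => 0) D.isColoringOff_gen
  have hcut : ∀ x y : D.Crossing, x ≠ y → ∃ S, D.IsCut S ∧ x ∈ S ∧ y ∉ S := fun x y hxy =>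
    exists_cut_of_gen_eq ha hconn hxy ((hg _).trans (hg _).symm)
  obtain ⟨v⟩ := hne
  obtain ⟨S₀, hS₀, -⟩ := hcut v (D.opp (v, 1)).1 (hloop (v, 1)).symm
  obtain ⟨S, hS, hmin⟩ := Set.exists_min_image {S | D.IsCut S} Set.ncard (Set.toFinite _) ⟨S₀, hS₀⟩
  have hS : D.IsCut S := hS
  have hmin : ∀ T, D.IsCut T → S.ncard ≤ T.ncard := hmin
  by_cases hsub : S.Subsingleton
  · obtain ⟨x, hx⟩ := hS.nonempty
    -- Without loops both over-darts of a single crossing leave it, one too many for a cut.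
    have hin : ∀ d : D.Dart, IsOver d → d.1 = x → d ∈ D.overBoundary S := fun d ho hd =>
      ⟨ho, hd ▸ hx, fun h => hloop d (hsub h (hd ▸ hx))⟩
    have h1 := hin (x, 1) (Or.inl rfl) rfl
    have h3 := hin (across (x, 1)) (Or.inr rfl) rfl
    exact across_ne _ ((Set.ncard_le_one (Set.toFinite _)).1 hS.ncard_le _ h3 _ h1)
  · rw [Set.not_subsingleton_iff] at hsub
    obtain ⟨x, hx, y, hy, hxy⟩ := hsub
    obtain ⟨T, hT, hxT, hyT⟩ := hcut x y hxy
    -- Uncrossing: if `S ∪ T` is everything, `Tᶜ` is a smaller cut. Otherwise `S ∪ T` has at least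
    -- one boundary over-dart, and submodularity leaves at most one for `S ∩ T`.
    by_cases hU : S ∪ T = Set.univ
    · have h1 := hmin _ (hT.compl ha)
      have h2 : Tᶜ ⊂ S := by
        refine ⟨fun z hz => ?_, fun h => h hx hxT⟩
        exact (hU.symm ▸ Set.mem_univ z : z ∈ S ∪ T).resolve_right hz
      exact absurd (Set.ncard_lt_ncard h2) (by omega)
    · have h1 := ncard_overBoundary_inter_add_union S T
      have h2 := one_le_ncard_overBoundary ha hconn ⟨x, Or.inl hx⟩ hU
      have h3 := hS.ncard_le
      have h4 := hT.ncard_le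
      have hne' : S ∩ T ≠ Set.univ := fun h => hyT (h ▸ Set.mem_univ y : y ∈ S ∩ T).2
      have h5 := hmin (S ∩ T) ⟨⟨x, hx, hxT⟩, hne', by omega⟩
      have h6 : S ∩ T ⊂ S := ⟨Set.inter_subset_left, fun h => hyT (h hy).2⟩
      exact absurd (Set.ncard_lt_ncard h6) (by omega)

/-! ### Isomorphisms preserve planarity -/

/-- `Step` asks for planarity at both ends, so this is what makes an isomorphic diagram represent
the same link. -/
theorem Iso.planar (h : Iso D D') (hD : D.Planar) : D'.Planar := by
  obtain ⟨e, r, -, hopp, -⟩ := h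
  let φ : D.Dart ≃ D'.Dart :=
    { toFun := fun d => (e d.1, d.2 + r d.1)
      invFun := fun d => (e.symm d.1, d.2 - r (e.symm d.1))
      left_inv := fun d => by simp
      right_inv := fun d => by simp }
  have hφ : ∀ d, D'.opp (φ d) = φ (D.opp d) := hopp
  have hnext : ∀ d, D'.next (φ d) = φ (D.next d) := fun d => by
    rw [next, hφ]
    exact Prod.ext rfl (add_right_comm _ _ _)
  have hF : Nat.card D.Face = Nat.card D'.Face := by
    refine Nat.card_congr (Quot.congr φ fun d d' => ?_)
    rw [hnext, φ.apply_eq_iff_eq]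
  have hG : Nat.card D.GraphComponent = Nat.card D'.GraphComponent := by
    refine Nat.card_congr (Quot.congr e fun v w => ?_)
    constructor
    · rintro ⟨i, j, h⟩
      refine ⟨i + r v, j + r w, ?_⟩
      have := hopp (v, i)
      rwa [h] at this
    · rintro ⟨i, j, h⟩
      have := hopp (v, i - r v)
      simp only [sub_add_cancel] at this
      rw [h] at this
      have hw := e.injective (congrArg Prod.fst this)
      exact ⟨i - r v, (D.opp (v, i - r v)).2, Prod.ext hw.symm rfl⟩
  have hV : Nat.card D.Crossing = Nat.card D'.Crossing := Nat.card_congr e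
  rw [Planar] at hD ⊢
  rw [← hF, ← hG, ← hV, hD]

/-! ### Faces of reduced alternating diagrams -/

theorem isOver_next (ha : D.Alternating) (d : D.Dart) : IsOver (D.next d) ↔ IsOver d := by
  rw [next, isOver_rot, ha, not_not]

theorem next_injective (D : LinkDiagram) : Function.Injective D.next :=
  rot_injective.comp D.opp_injective

theorem face_next (d : D.Dart) : (Quot.mk _ (D.next d) : D.Face) = Quot.mk _ d :=
  (Quot.sound (r := fun d e : D.Dart => e = D.next d) rfl).symm

theorem face_iterate (d : D.Dart) (n : ℕ) :
    (Quot.mk _ (D.next^[n] d) : D.Face) = Quot.mk _ d := by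
  induction n with
  | zero => rfl
  | succ n ih => rw [Function.iterate_succ_apply', face_next, ih]

theorem Reduced.face_ne (hred : D.Reduced) (d : D.Dart) :
    (Quot.mk _ d : D.Face) ≠ Quot.mk _ (across d) := fun h => hred d.1 ⟨d.2, h⟩

theorem eq_rot_or_eq_rot {d e : D.Dart} (h : d.1 = e.1) (ho : IsOver d ↔ ¬ IsOver e) :
    e = rot d ∨ d = rot e := by
  have key : ∀ i j : ZMod 4, ((i = 1 ∨ i = 3) ↔ ¬ (j = 1 ∨ j = 3)) → j = i + 1 ∨ i = j + 1 := by
    decide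
  exact (key _ _ ho).imp (Prod.ext h.symm) (Prod.ext h)

theorem rot_rot (d : D.Dart) : rot (rot d) = across d :=
  Prod.ext rfl ((add_assoc _ _ _).trans (congrArg _ (by decide)))

/-- By alternation a loop joins neighboring darts, and the face walk along it passes from a corner
to the opposite one, so the crossing is nugatory. -/
theorem Reduced.no_loop (hred : D.Reduced) (ha : D.Alternating) (d : D.Dart) :
    (D.opp d).1 ≠ d.1 := by
  intro h
  rcases eq_rot_or_eq_rot h (ha d) with h' | h'
  · refine hred.face_ne (D.opp d) ?_
    rw [← face_next, next, D.opp_opp, h', rot_rot, ← h']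
  · refine hred.face_ne d ?_
    rw [← face_next, next, h', rot_rot]

/-- The edges at the darts `p` and `q` of `S` are those which leave `S`. -/
structure EdgeCut (D : LinkDiagram) (S : Set D.Crossing) (p q : D.Dart) : Prop where
  fst_mem : p.1 ∈ S
  snd_mem : q.1 ∈ S
  not_isOver : ¬ IsOver p
  isOver : IsOver q
  opp_notMem_iff : ∀ d : D.Dart, d.1 ∈ S → ((D.opp d).1 ∉ S ↔ d = p ∨ d = q)

theorem IsCut.exists_edgeCut (ha : D.Alternating) (hconn : D.GraphConnected) {S : Set D.Crossing}
    (h : D.IsCut S) : ∃ p q, D.EdgeCut S p q := by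
  have := D.finite_dart
  have h1 : (D.overBoundary S).ncard = 1 :=
    le_antisymm h.ncard_le (one_le_ncard_overBoundary ha hconn h.nonempty h.ne_univ)
  have h2 := h1
  rw [ncard_overBoundary ha] at h2
  obtain ⟨q, hq⟩ := Set.ncard_eq_one.1 h1
  obtain ⟨p, hp⟩ := Set.ncard_eq_one.1 h2
  have hq' : q ∈ D.overBoundary S := hq ▸ rfl
  have hp' : p ∈ D.underBoundary S := hp ▸ rfl
  refine ⟨p, q, hp'.2.1, hq'.2.1, hp'.1, hq'.1, fun d hd => ⟨fun hd' => ?_, ?_⟩⟩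
  · by_cases ho : IsOver d
    · exact Or.inr (hq.subset (⟨ho, hd, hd'⟩ : d ∈ D.overBoundary S))
    · exact Or.inl (hp.subset (⟨ho, hd, hd'⟩ : d ∈ D.underBoundary S))
  · rintro (rfl | rfl)
    exacts [hp'.2.2, hq'.2.2]

namespace EdgeCut

variable {S : Set D.Crossing} {p q : D.Dart}

theorem ne (h : D.EdgeCut S p q) : p ≠ q := fun e => h.not_isOver (e ▸ h.isOver)

theorem opp_fst (h : D.EdgeCut S p q) : (D.opp p).1 ∉ S :=
  (h.opp_notMem_iff p h.fst_mem).2 (Or.inl rfl)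

theorem opp_snd (h : D.EdgeCut S p q) : (D.opp q).1 ∉ S :=
  (h.opp_notMem_iff q h.snd_mem).2 (Or.inr rfl)

theorem opp_mem (h : D.EdgeCut S p q) {d : D.Dart} (hd : d.1 ∈ S) (hp : d ≠ p) (hq : d ≠ q) :
    (D.opp d).1 ∈ S := by
  by_contra hd'
  rcases (h.opp_notMem_iff d hd).1 hd' with e | e
  exacts [hp e, hq e]

theorem compl (ha : D.Alternating) (h : D.EdgeCut S p q) :
    D.EdgeCut Sᶜ (D.opp q) (D.opp p) := by
  refine ⟨h.opp_snd, h.opp_fst, fun h' => (ha q).1 h' h.isOver, (ha p).2 h.not_isOver,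
    fun d hd => ?_⟩
  rw [Set.notMem_compl_iff]
  constructor
  · intro hd'
    have := (h.opp_notMem_iff _ hd').1 (by rwa [D.opp_opp])
    rw [opp_eq_iff, opp_eq_iff] at this
    exact this.symm
  · rintro (rfl | rfl) <;> rw [D.opp_opp]
    exacts [h.snd_mem, h.fst_mem]

end EdgeCut

/-- The face to the left of one of the two edges leaving `S` returns to `S` along the other. -/
theorem face_eq_of_cut (ha : D.Alternating) {S : Set D.Crossing} {p q : D.Dart}
    (hpq : IsOver p ↔ ¬ IsOver q) (hp : p.1 ∈ S)
    (hS : ∀ d : D.Dart, d.1 ∈ S → ((D.opp d).1 ∉ S ↔ d = p ∨ d = q)) :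
    (Quot.mk _ p : D.Face) = Quot.mk _ (rot q) := by
  classical
  have := D.finite_dart
  obtain ⟨k, hk, hk'⟩ := D.next_injective.mem_periodicPts p
  -- The walk around the face is periodic, hence returns to `S`; its first return is considered.
  have hex : ∃ n, 0 < n ∧ (D.next^[n] p).1 ∈ S := ⟨k, hk, by rw [hk'.eq]; exact hp⟩
  obtain ⟨hn, hnS⟩ := Nat.find_spec hex
  obtain ⟨m, hm⟩ : ∃ m, Nat.find hex = m + 1 := ⟨_, (Nat.succ_pred_eq_of_pos hn).symm⟩
  rw [hm, Function.iterate_succ_apply'] at hnS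
  have hpar : ∀ n, IsOver (D.next^[n] p) ↔ IsOver p := fun n => by
    induction n with
    | zero => rfl
    | succ n ih => rw [Function.iterate_succ_apply', isOver_next ha, ih]
  have hmem : (D.opp (D.next^[m] p)).1 ∈ S := hnS
  have hout : (D.next^[m] p).1 ∉ S := by
    rcases Nat.eq_zero_or_pos m with rfl | hm0
    · exact absurd hmem ((hS p hp).2 (Or.inl rfl))
    · exact fun h => Nat.find_min hex (m := m) (by omega) ⟨hm0, h⟩
  -- Face walks preserve over/under while edges exchange them, so the return is not along `p`.
  rcases (hS _ hmem).1 (by rwa [D.opp_opp]) with h | h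
  · have h1 := ha (D.next^[m] p)
    rw [h, hpar m] at h1
    tauto
  · rw [← face_iterate p (m + 1), Function.iterate_succ_apply', next, h]

/-- If both edges left from one crossing, the faces beside the cut would contain two opposite
corners there, making it nugatory. -/
theorem EdgeCut.fst_ne (ha : D.Alternating) (hred : D.Reduced) {S : Set D.Crossing} {p q : D.Dart}
    (h : D.EdgeCut S p q) : p.1 ≠ q.1 := by
  intro e
  have h1 := face_eq_of_cut ha (iff_of_false h.not_isOver fun h' => h' h.isOver) h.fst_mem
    h.opp_notMem_iff
  have h2 := face_eq_of_cut ha (iff_of_true h.isOver h.not_isOver) h.snd_mem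
    fun d hd => (h.opp_notMem_iff d hd).trans or_comm
  rcases eq_rot_or_eq_rot e (iff_of_false h.not_isOver fun h' => h' h.isOver) with e' | e'
  · rw [e', rot_rot] at h1
    exact hred.face_ne _ h1
  · rw [e', rot_rot] at h2
    exact hred.face_ne _ h2

/-! ### Cutting a diagram along two edges -/

open scoped Classical in
/-- Join the darts `p` and `q`. -/
noncomputable def rejoin (D : LinkDiagram) (p q d : D.Dart) : D.Dart :=
  if d = p then q else if d = q then p else D.opp d

theorem rejoin_fst (p q : D.Dart) : D.rejoin p q p = q := if_pos rfl

theorem rejoin_snd (p q : D.Dart) : D.rejoin p q q = p := by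
  by_cases h : q = p <;> simp [rejoin, h]

theorem rejoin_of_ne {p q d : D.Dart} (hp : d ≠ p) (hq : d ≠ q) : D.rejoin p q d = D.opp d := by
  simp [rejoin, hp, hq]

namespace EdgeCut

variable {S : Set D.Crossing} {p q : D.Dart}

theorem rejoin_mem (h : D.EdgeCut S p q) {d : D.Dart} (hd : d.1 ∈ S) : (D.rejoin p q d).1 ∈ S := by
  by_cases hp : d = p
  · rw [hp, rejoin_fst]; exact h.snd_mem
  by_cases hq : d = q
  · rw [hq, rejoin_snd]; exact h.fst_mem
  rw [rejoin_of_ne hp hq]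
  exact h.opp_mem hd hp hq

theorem rejoin_rejoin (h : D.EdgeCut S p q) {d : D.Dart} (hd : d.1 ∈ S) :
    D.rejoin p q (D.rejoin p q d) = d := by
  by_cases hp : d = p
  · rw [hp, rejoin_fst, rejoin_snd]
  by_cases hq : d = q
  · rw [hq, rejoin_snd, rejoin_fst]
  rw [rejoin_of_ne hp hq, rejoin_of_ne, D.opp_opp]
  · intro e
    rw [opp_eq_iff] at e
    exact h.opp_fst (e ▸ hd)
  · intro e
    rw [opp_eq_iff] at e
    exact h.opp_snd (e ▸ hd)

theorem rejoin_ne (h : D.EdgeCut S p q) (d : D.Dart) : D.rejoin p q d ≠ d := by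
  by_cases hp : d = p
  · rw [hp, rejoin_fst]; exact h.ne.symm
  by_cases hq : d = q
  · rw [hq, rejoin_snd]; exact h.ne
  rw [rejoin_of_ne hp hq]
  exact D.opp_ne d

theorem isOver_rejoin (h : D.EdgeCut S p q) (ha : D.Alternating) (d : D.Dart) :
    IsOver (D.rejoin p q d) ↔ ¬ IsOver d := by
  by_cases hp : d = p
  · rw [hp, rejoin_fst]; exact iff_of_true h.isOver h.not_isOver
  by_cases hq : d = q
  · rw [hq, rejoin_snd]; exact iff_of_false h.not_isOver fun h' => h' h.isOver
  rw [rejoin_of_ne hp hq]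
  exact ha d

/-- The diagram on the crossings in `S` where the two edges leaving `S` are joined. -/
noncomputable def side (h : D.EdgeCut S p q) : LinkDiagram where
  Crossing := S
  finite_crossing := by
    have := D.finite_crossing
    infer_instance
  opp := fun d => (⟨(D.rejoin p q (d.1.1, d.2)).1, h.rejoin_mem d.1.2⟩,
    (D.rejoin p q (d.1.1, d.2)).2)
  opp_opp := fun d => by
    have := h.rejoin_rejoin (d := (d.1.1, d.2)) d.1.2
    exact Prod.ext (Subtype.ext (congrArg Prod.fst this)) (congrArg Prod.snd this :)
  opp_ne := fun d e => h.rejoin_ne (d.1.1, d.2)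
    (congrArg (fun x : S × ZMod 4 => ((x.1.1, x.2) : D.Dart)) e)
  circles := 0

theorem side_opp (h : D.EdgeCut S p q) (d : h.side.Dart) :
    (((h.side.opp d).1.1, (h.side.opp d).2) : D.Dart) = D.rejoin p q (d.1.1, d.2) := rfl

theorem side_alternating (h : D.EdgeCut S p q) (ha : D.Alternating) : h.side.Alternating :=
  fun d => h.isOver_rejoin ha (d.1.1, d.2)

theorem side_no_loop (h : D.EdgeCut S p q) (ha : D.Alternating) (hred : D.Reduced)
    (d : h.side.Dart) :
    (h.side.opp d).1 ≠ d.1 := by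
  intro e
  have e' : (D.rejoin p q (d.1.1, d.2)).1 = d.1.1 := congrArg Subtype.val e
  by_cases hp : (d.1.1, d.2) = p
  · rw [hp, rejoin_fst] at e'
    exact h.fst_ne ha hred ((congrArg Prod.fst hp).symm.trans e'.symm)
  by_cases hq : (d.1.1, d.2) = q
  · rw [hq, rejoin_snd] at e'
    exact h.fst_ne ha hred (e'.trans (congrArg Prod.fst hq))
  rw [rejoin_of_ne hp hq] at e'
  exact hred.no_loop ha _ e'

/-- A closed set of the side contains both ends of the new edge or neither. If neither, it is closed
in `D`; if both, its complement in `S` is. -/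
theorem side_connected (h : D.EdgeCut S p q) (hconn : D.GraphConnected) :
    h.side.GraphConnected := by
  intro T' hT' hclosed
  let T : Set D.Crossing := Subtype.val '' T'
  have hTS : ∀ v ∈ T, v ∈ S := by
    rintro _ ⟨v, -, rfl⟩
    exact v.2
  have hT : ∀ d : D.Dart, d.1 ∈ T → (D.rejoin p q d).1 ∈ T := by
    rintro ⟨v, i⟩ ⟨w, hw, hwv⟩
    obtain rfl : w.1 = v := hwv
    exact ⟨_, hclosed (w, i) hw, rfl⟩
  have hne : T.Nonempty := hT'.image _
  have hpq : p.1 ∈ T → q.1 ∈ T := fun hp => by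
    have := hT p hp
    rwa [rejoin_fst] at this
  have hqp : q.1 ∈ T → p.1 ∈ T := fun hq => by
    have := hT q hq
    rwa [rejoin_snd] at this
  have hnuniv : S ≠ Set.univ := fun e => h.opp_fst (e ▸ Set.mem_univ _)
  by_cases hp : p.1 ∈ T
  · have hST : S \ T = ∅ := by
      by_contra hne'
      have := hconn (S \ T) (Set.nonempty_iff_ne_empty.2 hne') fun d hd => ?_
      · exact (this ▸ Set.mem_univ p.1 : p.1 ∈ S \ T).2 hp
      · have hdp : d ≠ p := fun e => hd.2 (e ▸ hp)
        have hdq : d ≠ q := fun e => hd.2 (e ▸ hpq hp)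
        refine ⟨h.opp_mem hd.1 hdp hdq, fun hd' => hd.2 ?_⟩
        have h1 := hT _ hd'
        rw [← rejoin_of_ne hdp hdq, h.rejoin_rejoin hd.1] at h1
        exact h1
    ext v
    simp only [Set.mem_univ, iff_true]
    by_contra hv
    refine (Set.eq_empty_iff_forall_notMem.1 hST v.1) ⟨v.2, ?_⟩
    rintro ⟨w, hw, e⟩
    exact hv (Subtype.ext e ▸ hw)
  · have hq : q.1 ∉ T := fun hq => hp (hqp hq)
    have := hconn T hne fun d hd => by
      have h1 := hT d hd
      rwa [rejoin_of_ne] at h1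
      · exact fun e => hp (e ▸ hd)
      · exact fun e => hq (e ▸ hd)
    exact absurd (this ▸ Set.mem_univ p.1) hp

open scoped Classical in
/-- A diagram is the connected sum of the two sides of a cut. -/
theorem iso_connSum (h : D.EdgeCut S p q) (ha : D.Alternating) (hc : D.circles = 0) :
    Iso (connSum h.side (h.compl ha).side (⟨p.1, h.fst_mem⟩, p.2)
      (⟨(D.opp p).1, h.opp_fst⟩, (D.opp p).2))
      D := by
  let e : S ⊕ (Sᶜ : Set D.Crossing) ≃ D.Crossing := Equiv.Set.sumCompl S
  refine ⟨e, fun _ => 0, fun _ => Or.inl rfl, fun d => ?_, hc.symm⟩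
  simp only [add_zero]
  let J : (S ⊕ (Sᶜ : Set D.Crossing)) × ZMod 4 → D.Dart := fun d => (e d.1, d.2)
  have hJ : Function.Injective J := fun x y hxy =>
    Prod.ext (e.injective (congrArg Prod.fst hxy)) (congrArg Prod.snd hxy :)
  let O : D.Dart → D.Dart := fun x =>
    if x.1 ∈ S then D.rejoin p q x else D.rejoin (D.opp q) (D.opp p) x
  have hO : ∀ x, J (sumOpp h.side (h.compl ha).side x) = O (J x) := by
    rintro ⟨v | v, i⟩
    · exact (if_pos v.2).symm
    · exact (if_neg v.2).symm
  have hu : (((h.side.opp (⟨p.1, h.fst_mem⟩, p.2)).1.1,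
      (h.side.opp (⟨p.1, h.fst_mem⟩, p.2)).2) : D.Dart) = q :=
    (h.side_opp _).trans (rejoin_fst p q)
  -- `O` joins `p` to `q` and `opp q` to `opp p`; conjugation by the swap of `q` and `opp p`
  -- restores the original edges.
  have key : ∀ x : D.Dart, Equiv.swap q (D.opp p) (O (Equiv.swap q (D.opp p) x)) = D.opp x := by
    have hpS := h.fst_mem
    have hqS := h.snd_mem
    have hpS' := h.opp_fst
    have hqS' := h.opp_snd
    have n1 : p ≠ q := h.ne
    have n2 : p ≠ D.opp p := (D.opp_ne p).symm
    have n3 : D.opp q ≠ q := D.opp_ne q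
    have n4 : D.opp q ≠ D.opp p := fun e => n1 (D.opp_injective e).symm
    intro x
    by_cases hx1 : x = p
    · subst hx1
      rw [Equiv.swap_apply_of_ne_of_ne n1 n2]
      simp only [O, if_pos hpS, rejoin_fst, Equiv.swap_apply_left]
    by_cases hx2 : x = q
    · subst hx2
      rw [Equiv.swap_apply_left]
      simp only [O, if_neg hpS', rejoin_snd]
      rw [Equiv.swap_apply_of_ne_of_ne n3 n4]
    by_cases hx3 : x = D.opp p
    · subst hx3
      rw [Equiv.swap_apply_right]
      simp only [O, if_pos hqS, rejoin_snd]
      rw [Equiv.swap_apply_of_ne_of_ne n1 n2, D.opp_opp]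
    by_cases hx4 : x = D.opp q
    · subst hx4
      rw [Equiv.swap_apply_of_ne_of_ne n3 n4]
      simp only [O, if_neg hqS', rejoin_fst]
      rw [Equiv.swap_apply_right, D.opp_opp]
    have hOx : O x = D.opp x := by
      by_cases hx : x.1 ∈ S
      · simp only [O, if_pos hx, rejoin_of_ne hx1 hx2]
      · simp only [O, if_neg hx, rejoin_of_ne hx4 hx3]
    rw [Equiv.swap_apply_of_ne_of_ne hx2 hx3, hOx, Equiv.swap_apply_of_ne_of_ne]
    · rwa [Ne, opp_eq_iff]
    · exact fun e => hx1 (D.opp_injective e)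
  have hs : ∀ (_ : DecidableEq ((S ⊕ (Sᶜ : Set D.Crossing)) × ZMod 4)) x,
      J (Equiv.swap ((Sum.inl (h.side.opp (⟨p.1, h.fst_mem⟩, p.2)).1,
        (h.side.opp (⟨p.1, h.fst_mem⟩, p.2)).2) : (S ⊕ (Sᶜ : Set D.Crossing)) × ZMod 4)
        (Sum.inr ⟨(D.opp p).1, h.opp_fst⟩, (D.opp p).2) x) =
      Equiv.swap q (D.opp p) (J x) := fun _ x => by
    rw [← hJ.swap_apply]
    congr 2
  exact (key (J d)).symm.trans (((congrArg (fun x => Equiv.swap q (D.opp p) (O x))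
    (hs _ d).symm).trans (congrArg (Equiv.swap q (D.opp p)) (hO _).symm)).trans (hs _ _).symm)

end EdgeCut

/-! ### Prime alternating links -/

theorem graphConnected_of_subsingleton (h : Subsingleton D.GraphComponent) : D.GraphConnected := by
  intro S hS hclosed
  have hiff : ∀ d : D.Dart, d.1 ∈ S ↔ (D.opp d).1 ∈ S := fun d =>
    ⟨hclosed d, fun hd => by have := hclosed _ hd; rwa [D.opp_opp] at this⟩
  let P : D.GraphComponent → Prop := Quot.lift (· ∈ S) (by
    rintro v w ⟨i, j, hij⟩
    have := hiff (v, i)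
    rw [hij] at this
    exact propext this)
  obtain ⟨v, hv⟩ := hS
  refine Set.eq_univ_of_forall fun w => ?_
  have hwv : (Quot.mk _ w : D.GraphComponent) = Quot.mk _ v := h.elim _ _
  have : P (Quot.mk _ w) = P (Quot.mk _ v) := congrArg P hwv
  exact this.mpr hv

theorem RepresentsPrimeLink.connected (hplanar : D.Planar) (hprime : D.RepresentsPrimeLink) :
    Nonempty D.Crossing ∧ D.circles = 0 ∧ D.GraphConnected := by
  have := D.finite_crossing
  have : Finite D.GraphComponent := Quot.finite _
  have h1 : Nat.card D.GraphComponent + D.circles = 1 := hprime.2.1 D (.refl D)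
  rcases isEmpty_or_nonempty D.Crossing with he | hne
  · exfalso
    have : IsEmpty D.GraphComponent := ⟨fun c => he.elim (Quot.exists_rep c).choose⟩
    rw [Nat.card_of_isEmpty, zero_add] at h1
    have hi : Iso D unknot :=
      ⟨(Equiv.equivEmpty D.Crossing), fun _ => 0, fun _ => Or.inl rfl, fun d => he.elim d.1, h1⟩
    exact hprime.1 (.rel _ _ ⟨hplanar, hi.planar hplanar, Or.inl hi⟩)
  · have : Nonempty D.GraphComponent := hne.map (Quot.mk _)
    have h2 : 0 < Nat.card D.GraphComponent := Nat.card_pos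
    refine ⟨hne, by omega, graphConnected_of_subsingleton ?_⟩
    exact (Nat.card_eq_one_iff_unique.1 (by omega)).1

/-- A reduced alternating diagram of a prime link is a prime diagram. -/
theorem RepresentsPrimeLink.not_isCut (hplanar : D.Planar) (hred : D.Reduced) (ha : D.Alternating)
    (hprime : D.RepresentsPrimeLink) (S : Set D.Crossing) : ¬ D.IsCut S := by
  intro hS
  obtain ⟨-, hc, hconn⟩ := hprime.connected hplanar
  obtain ⟨p, q, h⟩ := hS.exists_edgeCut ha hconn
  -- Neither summand is an unknot, since each has a non-constant coloring.
  have hside : ∀ {S : Set D.Crossing} {p q : D.Dart} (h : D.EdgeCut S p q),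
      ¬ h.side.SameLink unknot := fun h hs => by
    obtain ⟨A, _, hA⟩ := not_rigidOff (h.side_alternating ha) (h.side_connected hconn)
      (h.side_no_loop ha hred) ⟨⟨_, h.fst_mem⟩⟩
    exact hA (hs.rigidOff_iff.2 rigidOff_unknot)
  have hi := (h.iso_connSum ha hc).symm
  have hsame : D.SameLink _ := .rel _ _ ⟨hplanar, hi.planar hplanar, Or.inl hi⟩
  rcases hprime.2.2 _ _ _ _ hsame with h' | h'
  · exact hside h h'
  · exact hside (h.compl ha) h'

theorem gen_injective (hplanar : D.Planar) (hred : D.Reduced) (ha : D.Alternating)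
    (hprime : D.RepresentsPrimeLink) : Function.Injective D.gen := by
  obtain ⟨-, hc, hconn⟩ := hprime.connected hplanar
  intro a b hab
  obtain ⟨x, rfl⟩ := exists_arc_eq ha hc a
  obtain ⟨y, rfl⟩ := exists_arc_eq ha hc b
  by_contra hne
  have hxy : x ≠ y := fun e => hne (by rw [e])
  obtain ⟨S, hS, -⟩ := exists_cut_of_gen_eq ha hconn hxy hab
  exact hprime.not_isCut hplanar hred ha S hS

/-! ### Colorings as homomorphisms -/

/-- The homomorphism on `Col(D)` with given values on the arcs. -/
noncomputable def colLift {A : Type} [AddCommGroup A] (f : D.Arc → A)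
    (hf : ∀ v : D.Crossing, 2 • f (D.arc (v, 1)) - f (D.arc (v, 0)) - f (D.arc (v, 2)) = 0) :
    D.Col →+ A :=
  QuotientAddGroup.lift _ (Finsupp.liftAddHom fun a => zmultiplesHom A (f a)) (by
    rw [AddSubgroup.closure_le]
    rintro _ ⟨v, rfl⟩
    rw [SetLike.mem_coe, AddMonoidHom.mem_ker, ← hf v]
    simp only [relator, map_sub, map_nsmul, Finsupp.liftAddHom_apply_single, zmultiplesHom_apply,
      one_zsmul])

theorem colLift_gen {A : Type} [AddCommGroup A] (f : D.Arc → A)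
    (hf : ∀ v : D.Crossing, 2 • f (D.arc (v, 1)) - f (D.arc (v, 0)) - f (D.arc (v, 2)) = 0)
    (a : D.Arc) : colLift f hf (D.gen a) = f a := by
  refine (QuotientAddGroup.lift_mk _ _ _).trans ?_
  simp

theorem gen_relation (v : D.Crossing) :
    2 • D.gen (D.arc (v, 1)) - D.gen (D.arc (v, 0)) - D.gen (D.arc (v, 2)) = 0 := by
  have h := (isColoringOff_gen D).crossing v (Set.notMem_empty _)
  rw [two_nsmul, h]
  abel

/-- The class of an arc in the reduced group of colorings. -/
noncomputable def redGen (D : LinkDiagram) (b a : D.Arc) : D.ColRed b :=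
  QuotientAddGroup.mk (D.gen a)

/-- The degree homomorphism sends every generator to `1`. A difference of two generators has degree
`0`, so it is a multiple of the base generator only if it vanishes. -/
theorem redGen_injective {b : D.Arc} (h : Function.Injective D.gen) :
    Function.Injective (D.redGen b) := by
  intro x y hxy
  obtain ⟨m, hm⟩ := AddSubgroup.mem_zmultiples_iff.1 (QuotientAddGroup.eq.1 hxy)
  have hε : ∀ v : D.Crossing, 2 • (fun _ : D.Arc => (1 : ℤ)) (D.arc (v, 1)) - 1 - 1 = 0 := by simp
  have h1 := congrArg (colLift (fun _ : D.Arc => (1 : ℤ)) hε) hm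
  rw [map_zsmul, map_add, map_neg, colLift_gen, colLift_gen, colLift_gen] at h1
  have hm0 : m = 0 := by simpa using h1
  rw [hm0, zero_zsmul] at hm
  exact h (neg_add_eq_zero.1 hm.symm)

theorem isFoxColoring_redGen {b : D.Arc} {n : ℕ} (φ : D.ColRed b →+ ZMod n) :
    D.IsFoxColoring n fun a => φ (D.redGen b a) := by
  intro v
  have h := congrArg (fun x : D.Col => φ (QuotientAddGroup.mk x)) (gen_relation v)
  simpa [redGen, QuotientAddGroup.mk_sub, QuotientAddGroup.mk_nsmul] using h

theorem exists_hom_of_isFoxColoring (b : D.Arc) {n : ℕ} {f : D.Arc → ZMod n}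
    (hf : D.IsFoxColoring n f) :
    ∃ ψ : D.ColRed b →+ ZMod n, ∀ a, ψ (D.redGen b a) = f a - f b := by
  have hf' : ∀ v : D.Crossing, 2 • (fun a => f a - f b) (D.arc (v, 1)) -
      (fun a => f a - f b) (D.arc (v, 0)) - (fun a => f a - f b) (D.arc (v, 2)) = 0 := fun v => by
    rw [← hf v]
    simp only [nsmul_eq_mul, Nat.cast_ofNat]
    ring
  refine ⟨QuotientAddGroup.lift _ (colLift (fun a => f a - f b) hf') ?_, fun a => ?_⟩
  · rw [AddSubgroup.zmultiples_le, AddMonoidHom.mem_ker, colLift_gen, sub_self]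
  · exact (QuotientAddGroup.lift_mk _ _ _).trans (colLift_gen (fun a => f a - f b) hf' a)

end LinkDiagram

/-! ### Endomorphisms of groups of prime order, and the conclusion -/

theorem ZMod.addMonoidHom_injective_of_prime {p : ℕ} (hp : p.Prime) {φ : ZMod p →+ ZMod p}
    (h : φ ≠ 0) : Function.Injective φ := by
  have : Fact p.Prime := ⟨hp⟩
  have hφ : ∀ z, φ z = z * φ 1 := fun z => by
    have := ZMod.map_smul φ z 1
    simpa using this
  have h1 : φ 1 ≠ 0 := fun e => h (AddMonoidHom.ext fun z => by rw [hφ, e, mul_zero]; rfl)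
  intro z w hzw
  rw [hφ z, hφ w] at hzw
  exact mul_right_cancel₀ h1 hzw

theorem corollary3p6 (D : LinkDiagram) (hplanar : D.Planar) (hreduced : D.Reduced)
    (halternating : D.Alternating) (hprime : D.RepresentsPrimeLink)
    (b : D.Arc) (n₁ : ℕ) (hn₁ : 0 < n₁) (hcyclic : Nonempty (D.ColRed b ≃+ ZMod n₁)) :
    (∃ f : D.Arc → ZMod n₁, D.IsFoxColoring n₁ f ∧ (∃ x y, f x ≠ f y) ∧ Function.Injective f) ∧
    (n₁.Prime → ∀ f : D.Arc → ZMod n₁, D.IsFoxColoring n₁ f → (∃ x y, f x ≠ f y) →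
      Function.Injective f) := by
  obtain ⟨φ⟩ := hcyclic
  have hinj : Function.Injective (D.redGen b) :=
    LinkDiagram.redGen_injective (LinkDiagram.gen_injective hplanar hreduced halternating hprime)
  obtain ⟨⟨v⟩, -, -⟩ := hprime.connected hplanar
  -- The two ends of an edge are distinct crossings, which yields two distinct arcs and hence
  -- non-triviality.
  have hne : D.arc (v, 1) ≠ D.arc ((D.opp (v, 1)).1, 1) := fun h =>
    hreduced.no_loop halternating (v, 1)
      ((LinkDiagram.arc_eq_iff halternating (Or.inl rfl) (Or.inl rfl)).1 h).symm
  refine ⟨⟨fun a => φ (D.redGen b a), LinkDiagram.isFoxColoring_redGen φ.toAddMonoidHom,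
    ⟨_, _, fun h => hne (hinj (φ.injective h))⟩, φ.injective.comp hinj⟩, fun hp f hf hxy => ?_⟩
  obtain ⟨ψ, hψ⟩ := LinkDiagram.exists_hom_of_isFoxColoring b hf
  -- `χ` takes the injective coloring to `f - f b`.
  let χ : ZMod n₁ →+ ZMod n₁ := ψ.comp φ.symm.toAddMonoidHom
  have hχ : ∀ a, χ (φ (D.redGen b a)) = f a - f b := fun a => by
    rw [← hψ a]
    exact congrArg ψ (φ.symm_apply_apply _)
  have hχ0 : χ ≠ 0 := by
    intro h0
    obtain ⟨x, y, hxy⟩ := hxy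
    refine hxy (sub_left_injective (b := f b) ?_)
    change f x - f b = f y - f b
    rw [← hχ, ← hχ, h0]
    rfl
  intro x y hxy
  refine hinj (φ.injective (ZMod.addMonoidHom_injective_of_prime hp hχ0 ?_))
  rw [hχ, hχ, hxy]
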